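/- For each $n\ge 1$ let $\{(a_{j,n},b_{j,n});\,j\in\mathbb Z\}$ be independent pairs of complex random variables, $a_{j,n}=x_{j,n}+\mathrm i y_{j,n}$, $b_{j,n}=x'_{j,n}+\mathrm i y'_{j,n}$, with $\mathbf E a_{j,n}=\mathbf E b_{j,n}=0$ and $\mathbf E|a_{j,n}|^2=\mathbf E|b_{j,n}|^2=1$. Suppose that the second moments $$\mathbf E[x_{j,n}^2],\ \mathbf E[y_{j,n}^2],\ \mathbf E[x_{j,n}'^2],\ \mathbf E[y_{j,n}'^2]$$ and the mixed moments $$\mathbf E[x_{j,n}y_{j,n}]=\rho_1,\ \mathbf E[x_{j,n}x'_{j,n}]=\rho_2,\ \mathbf E[x_{j,n}y'_{j,n}]=\rho_3,\ \mathbf E[x'_{j,n}y_{j,n}]=\rho_4,\ \mathbf E[x'_{j,n}y'_{j,n}]=\rho_5,\ \mathbf E[y_{j,n}y'_{j,n}]=\rho_6$$ do not depend on $j$ and $n$, and that for every $k\ge1$ the numbers $\mathbf E|x_{j,n}|^k,\mathbf E|y_{j,n}|^k,\mathbf E|x'_{j,n}|^k,\mathbf E|y'_{j,n}|^k$ are bounded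 by a constant $c_k<\infty$ independent of $j$ and $n$. For sequences $s,t$ indexed by $\mathbb Z$, the $n\times n$ generalized Toeplitz matrix with inputs $s,t$ has $(i,j)$ entry $s_{i-j}$ if $i+j\le n$ and $t_{i-j}$ if $i+j\ge n+1$ ($1\le i,j\le n$). Let $T_{n,g}$ be the one with inputs $(a_{j,n})_j,(b_{j,n})_j$, and for $1\le i\le m$ let $D^{(i)}_{n,g}$ be the one with deterministic complex inputs $d'^{(i)},d''^{(i)}$ (not depending on $n$) such that $\sum_{k\in\mathbb Z}|d'^{(i)}_k|<\infty$ and $\sum_{k\in\mathbb Z}|d''^{(i)}_k|<\infty$. Let $P_n$ be the $n\times n$ backward identity permutation matrix, with $(i,j)$ entry $1$ if $i+j=n+1$ and $0$ otherwise. Matrices $A_{1,n},\dots,A_{p,n}$ (random, $n\times n$, entries with all moments finite) are said to converge jointly in $*$-distribution if there are a unital $*$-algebra $\mathcal A$ over $\mathbb C$, a linear functional $\varphi$ on $\mathcal A$ with $\varphi(1)=1$ and $\varphi(aa^*)\ge0$ for all $a\in\mathcal A$, and $a_1,\dots,a_p\in\mathcal A$ such that $$\lim_{n\to\infty}\frac1n\mathbf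 E\,\mathrm{Tr}\bigl(A_{i_1,n}^{\epsilon_1}\cdots A_{i_k,n}^{\epsilon_k}\bigr)=\varphi\bigl(a_{i_1}^{\epsilon_1}\cdots a_{i_k}^{\epsilon_k}\bigr)$$ for all $k\ge1$, $i_1,\dots,i_k\in\{1,\dots,p\}$ and $\epsilon_1,\dots,\epsilon_k\in\{1,*\}$. (1) If, for each $n$, $B_n^{(1)},\dots,B_n^{(m)}$ are independent copies of $n^{-1/2}T_{n,g}$, then $\{P_n,\,B_n^{(i)},\,D_{n,g}^{(i)};\ 1\le i\le m\}$ converge jointly in $*$-distribution. (2) In particular, $\{P_n,\,n^{-1/2}T_{n,g},\,D_{n,g}\}$ converge jointly in $*$-distribution, for every deterministic generalized Toeplitz matrix $D_{n,g}$ with absolutely summable inputs. (3) Let $H_n$ be the asymmetric Hankel matrix whose $(i,j)$ entry is $a_{n+1-i-j,n}$ if $i>j$ and $b_{n+1-i-j,n}$ if $i\le j$. Then $H_n=P_nT_{n,g}$, and if, for each $n$, $C_n^{(1)},\dots,C_n^{(m)}$ are independent copies of $n^{-1/2}H_n$, then $\{P_n,\,C_n^{(i)},\,D_{n,g}^{(i)};\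 1\le i\le m\}$ converge jointly in $*$-distribution. -/

import Mathlib

open MeasureTheory ProbabilityTheory Filter Topology

/-! ### `*`-probability spaces and joint convergence in `*`-distribution -/

section StarProbability

open scoped ComplexOrder

/-- The functional `φ` of a `*`-probability space `(A, φ)`: linear, `φ 1 = 1`, and
`φ (a a*) ≥ 0` for every `a` (with the order of `ℂ`, so `φ (a a*)` is real and nonnegative). -/
structure StarState (A : Type*) [Ring A] [StarRing A] [Algebra ℂ A] where
  toLin : A →ₗ[ℂ] ℂ
  map_one : toLin 1 = 1
  nonneg : ∀ a : A, 0 ≤ toLin (a * star a)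

end StarProbability

/-- The monomial `x_{i₁}^{ε₁} ⋯ x_{i_k}^{ε_k}` of the word `[(i₁, ε₁), …, (i_k, ε_k)]`; the letter
`(i, false)` stands for `x_i` and `(i, true)` for `x_i^*`. -/
def starMonomial {ι A : Type*} [Monoid A] [Star A] (x : ι → A) (w : List (ι × Bool)) : A :=
  (w.map fun l => if l.2 then star (x l.1) else x l.1).prod

/-- The state `φ_n(M) = n⁻¹ E[Tr M]` on random `n × n` matrices. -/
noncomputable def traceState {Ω : Type*} [MeasurableSpace Ω] (μ : Measure Ω) {n : ℕ}
    (M : Ω → Matrix (Fin n) (Fin n) ℂ) : ℂ :=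
  (n : ℂ)⁻¹ * ∫ ω, (M ω).trace ∂μ

/-- The sequences of random matrices `M i n` (of size `n × n`, on the probability space
`(Ω n, μ n)`) have entries with all moments finite, and they converge jointly in
`*`-distribution to the elements `x i` of the `*`-probability space `(A, φ)`. -/
def ConvergesInStarDistribution {ι : Type*} {Ω : ℕ → Type*} [∀ n, MeasurableSpace (Ω n)]
    (μ : ∀ n, Measure (Ω n)) (M : ι → ∀ n, Ω n → Matrix (Fin n) (Fin n) ℂ)
    {A : Type*} [Ring A] [StarRing A] [Algebra ℂ A] (φ : StarState A) (x : ι → A) : Prop :=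
  (∀ (i : ι) (n : ℕ) (r s : Fin n) (k : ℕ), MemLp (fun ω => M i n ω r s) k (μ n)) ∧
  ∀ w : List (ι × Bool), w ≠ [] →
    Tendsto (fun n => traceState (μ n) fun ω => starMonomial (fun i => M i n ω) w) atTop
      (𝓝 (φ.toLin (starMonomial x w)))

/-- The sequences of random matrices `M i n` converge jointly in `*`-distribution to some elements
of some `*`-probability space. -/
def ConvergeJointly {ι : Type*} {Ω : ℕ → Type*} [∀ n, MeasurableSpace (Ω n)]
    (μ : ∀ n, Measure (Ω n)) (M : ι → ∀ n, Ω n → Matrix (Fin n) (Fin n) ℂ) : Prop :=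
  ∃ (A : Type) (_ : Ring A) (_ : StarRing A) (_ : Algebra ℂ A) (_ : StarModule ℂ A)
    (φ : StarState A) (x : ι → A), ConvergesInStarDistribution μ M φ x

/-! ### The matrices -/

/-- The backward identity permutation matrix `P_n`. -/
def backwardIdentity (n : ℕ) : Matrix (Fin n) (Fin n) ℂ :=
  Matrix.of fun i j => if j = i.rev then 1 else 0

/-- The generalized Toeplitz matrix: with rows and columns numbered `1, …, n`, the `(i, j)` entry is
`a_{i-j}` if `i + j ≤ n` and `b_{i-j}` if `i + j ≥ n + 1`. (`Fin n` is numbered from `0`.) -/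
def genToeplitz (n : ℕ) (a b : ℤ → ℂ) : Matrix (Fin n) (Fin n) ℂ :=
  Matrix.of fun i j =>
    if (i.val + 1) + (j.val + 1) ≤ n then a ((i.val : ℤ) - (j.val : ℤ))
    else b ((i.val : ℤ) - (j.val : ℤ))

/-- The asymmetric Hankel matrix: with rows and columns numbered `1, …, n`, the `(i, j)` entry is
`a_{n+1-i-j}` below the diagonal (`j < i`) and `b_{n+1-i-j}` on and above it. -/
def asymHankel (n : ℕ) (a b : ℤ → ℂ) : Matrix (Fin n) (Fin n) ℂ :=
  Matrix.of fun i j =>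
    if j < i then a ((n : ℤ) + 1 - ((i.val : ℤ) + 1) - ((j.val : ℤ) + 1))
    else b ((n : ℤ) + 1 - ((i.val : ℤ) + 1) - ((j.val : ℤ) + 1))

/-- The random matrix `n^{-1/2} T_{n,g}` with random inputs `a`, `b`. -/
noncomputable def scaledToeplitz {Ω : Type*} (n : ℕ) (a b : ℤ → Ω → ℂ) (ω : Ω) :
    Matrix (Fin n) (Fin n) ℂ :=
  (((Real.sqrt n)⁻¹ : ℝ) : ℂ) • genToeplitz n (fun j => a j ω) (fun j => b j ω)

/-- The random matrix `n^{-1/2} H_n` with random inputs `a`, `b`. -/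
noncomputable def scaledHankel {Ω : Type*} (n : ℕ) (a b : ℤ → Ω → ℂ) (ω : Ω) :
    Matrix (Fin n) (Fin n) ℂ :=
  (((Real.sqrt n)⁻¹ : ℝ) : ℂ) • asymHankel n (fun j => a j ω) (fun j => b j ω)

/-! ### Random inputs and independent copies -/

/-- The assumption on the pair `a = x + i y`, `b = x' + i y'` of random input sequences (for a fixed
size `n`): the pairs `(a_j, b_j)`, `j ∈ ℤ`, are independent; `a_j`, `b_j` have mean zero and variance
one; the second moments of `x_j, y_j, x'_j, y'_j` are `v 0, …, v 3` and their mixed moments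
`ρ 0, …, ρ 5` for every `j`; and the absolute moments of order `k` are at most `c k`. -/
structure InputAssumption {Ω : Type*} [MeasurableSpace Ω] (μ : Measure Ω)
    (v : Fin 4 → ℝ) (ρ : Fin 6 → ℝ) (c : ℕ → ℝ) (a b : ℤ → Ω → ℂ) : Prop where
  measurable_a : ∀ j, Measurable (a j)
  measurable_b : ∀ j, Measurable (b j)
  indep : iIndepFun (fun j ω => (a j ω, b j ω)) μ
  mean_a : ∀ j, ∫ ω, a j ω ∂μ = 0
  mean_b : ∀ j, ∫ ω, b j ω ∂μ = 0
  variance_a : ∀ j, ∫ ω, ‖a j ω‖ ^ 2 ∂μ = 1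
  variance_b : ∀ j, ∫ ω, ‖b j ω‖ ^ 2 ∂μ = 1
  sq_x : ∀ j, ∫ ω, (a j ω).re ^ 2 ∂μ = v 0
  sq_y : ∀ j, ∫ ω, (a j ω).im ^ 2 ∂μ = v 1
  sq_x' : ∀ j, ∫ ω, (b j ω).re ^ 2 ∂μ = v 2
  sq_y' : ∀ j, ∫ ω, (b j ω).im ^ 2 ∂μ = v 3
  corr_x_y : ∀ j, ∫ ω, (a j ω).re * (a j ω).im ∂μ = ρ 0
  corr_x_x' : ∀ j, ∫ ω, (a j ω).re * (b j ω).re ∂μ = ρ 1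
  corr_x_y' : ∀ j, ∫ ω, (a j ω).re * (b j ω).im ∂μ = ρ 2
  corr_x'_y : ∀ j, ∫ ω, (b j ω).re * (a j ω).im ∂μ = ρ 3
  corr_x'_y' : ∀ j, ∫ ω, (b j ω).re * (b j ω).im ∂μ = ρ 4
  corr_y_y' : ∀ j, ∫ ω, (a j ω).im * (b j ω).im ∂μ = ρ 5
  moment_x : ∀ j, ∀ k ≥ 1, Integrable (fun ω => |(a j ω).re| ^ k) μ ∧
    ∫ ω, |(a j ω).re| ^ k ∂μ ≤ c k
  moment_y : ∀ j, ∀ k ≥ 1, Integrable (fun ω => |(a j ω).im| ^ k) μ ∧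
    ∫ ω, |(a j ω).im| ^ k ∂μ ≤ c k
  moment_x' : ∀ j, ∀ k ≥ 1, Integrable (fun ω => |(b j ω).re| ^ k) μ ∧
    ∫ ω, |(b j ω).re| ^ k ∂μ ≤ c k
  moment_y' : ∀ j, ∀ k ≥ 1, Integrable (fun ω => |(b j ω).im| ^ k) μ ∧
    ∫ ω, |(b j ω).im| ^ k ∂μ ≤ c k

/-- The random matrices `C i` on `(Ω, μ)` are independent copies of the random matrix `M` on
`(Ω₀, μ₀)`: each has the law of `M`, and they are independent. Laws and independence are those of
the arrays of entries. -/
structure IsIndepCopies {ι Ω Ω₀ : Type*} [MeasurableSpace Ω] [MeasurableSpace Ω₀]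
    (μ : Measure Ω) (μ₀ : Measure Ω₀) {n : ℕ}
    (C : ι → Ω → Matrix (Fin n) (Fin n) ℂ) (M : Ω₀ → Matrix (Fin n) (Fin n) ℂ) : Prop where
  ident : ∀ i, IdentDistrib (fun ω (r s : Fin n) => C i ω r s) (fun ω (r s : Fin n) => M ω r s) μ μ₀
  indep : iIndepFun (fun i ω (r s : Fin n) => C i ω r s) μ

/-! ### The families of matrices -/

/-- Labels of the matrices `P_n`, `B_{n,1}^{(i)}` (random) and `B_{n,2}^{(i)}` (deterministic). -/
inductive MatrixLabel (m : ℕ) : Type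
  | perm : MatrixLabel m
  | rand (i : Fin m) : MatrixLabel m
  | det (i : Fin m) : MatrixLabel m

/-- The family consisting of `P_n`, of random matrices `R i n` and of the deterministic generalized
Toeplitz matrices with input sequences `d' i`, `d'' i`. -/
def matrixFamily {m : ℕ} {Ω : ℕ → Type*} (R : Fin m → ∀ n, Ω n → Matrix (Fin n) (Fin n) ℂ)
    (d' d'' : Fin m → ℤ → ℂ) : MatrixLabel m → ∀ n, Ω n → Matrix (Fin n) (Fin n) ℂ
  | .perm, n, _ => backwardIdentity n
  | .rand i, n, ω => R i n ω
  | .det i, n, _ => genToeplitz n (d' i) (d'' i)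

/-!
The free `*`-algebra on the index set with the functional given by limiting moments shows that
joint convergence is the same as convergence of every mixed moment. A mixed moment of order `k` is
a normalized sum over closed paths in `{1, …, n}`, and it is grouped by the coincidence pattern of
the random inputs that a path meets. By independence and centring a pattern with a singleton block
contributes nothing; a pattern with fewer than half as many blocks as random letters is negligible;
a pairing contributes a Riemann sum, which converges by dominated convergence because the indicator
functions involved are locally constant at almost every point. The coefficients of the deterministic
Toeplitz letters act as summable weights on the step sizes. For Hankel matrices, `H_n = P_n T_n` and
`P_n ^ 2 = 1`.
-/

/-! ### Random variables with all moments finite -/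

/-- All moments of `f` are finite. -/
def HasAllMoments {Ω 𝕜 : Type*} [MeasurableSpace Ω] [RCLike 𝕜] (μ : Measure Ω) (f : Ω → 𝕜) :
    Prop :=
  ∀ k : ℕ, MemLp f k μ

namespace HasAllMoments

variable {Ω 𝕜 : Type*} [MeasurableSpace Ω] [RCLike 𝕜] {μ : Measure Ω} {f g : Ω → 𝕜}

theorem const [IsFiniteMeasure μ] (c : 𝕜) : HasAllMoments μ fun _ => c := fun _ => memLp_const c

theorem mul (hf : HasAllMoments μ f) (hg : HasAllMoments μ g) :
    HasAllMoments μ fun ω => f ω * g ω := by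
  intro k
  have : ENNReal.HolderTriple ((2 * k : ℕ) : ENNReal) ((2 * k : ℕ) : ENNReal) (k : ENNReal) := by
    constructor
    rcases Nat.eq_zero_or_pos k with rfl | _
    · simp
    · push_cast
      rw [ENNReal.mul_inv (by simp) (by simp), ← add_mul, ENNReal.inv_two_add_inv_two, one_mul]
  exact (hg (2 * k)).mul (hf (2 * k))

theorem star (hf : HasAllMoments μ f) : HasAllMoments μ fun ω => star (f ω) :=
  fun k => (hf k).star

theorem sum {κ : Type*} (s : Finset κ) {F : κ → Ω → 𝕜}
    (hF : ∀ i ∈ s, HasAllMoments μ (F i)) : HasAllMoments μ fun ω => ∑ i ∈ s, F i ω :=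
  fun k => memLp_finsetSum s fun i hi => hF i hi k

theorem prod {κ : Type*} [IsFiniteMeasure μ] (s : Finset κ) {F : κ → Ω → 𝕜}
    (hF : ∀ i ∈ s, HasAllMoments μ (F i)) : HasAllMoments μ fun ω => ∏ i ∈ s, F i ω := by
  classical
  induction s using Finset.induction_on with
  | empty => simpa only [Finset.prod_empty] using const (μ := μ) (1 : 𝕜)
  | insert i s hi ih =>
    simp only [Finset.prod_insert hi]
    exact (hF i (Finset.mem_insert_self i s)).mul
      (ih fun j hj => hF j (Finset.mem_insert_of_mem hj))

theorem integrable (hf : HasAllMoments μ f) : Integrable f μ :=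
  memLp_one_iff_integrable.1 (by simpa only [Nat.cast_one] using hf 1)

theorem starMonomial {ι N : Type*} [Fintype N] [DecidableEq N] [IsFiniteMeasure μ]
    {M : ι → Ω → Matrix N N 𝕜} (hM : ∀ i r s, HasAllMoments μ fun ω => M i ω r s)
    (w : List (ι × Bool)) (r s : N) :
    HasAllMoments μ fun ω => starMonomial (fun i => M i ω) w r s := by
  induction w generalizing r with
  | nil =>
    simp only [_root_.starMonomial, List.map_nil, List.prod_nil]
    exact .const _
  | cons l w ih =>
    have first_letter : (fun ω => _root_.starMonomial (fun i => M i ω) (l :: w) r s) =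
        fun ω => ∑ t, (if l.2 then Star.star (M l.1 ω t r) else M l.1 ω r t) *
          _root_.starMonomial (fun i => M i ω) w t s := by
      funext ω
      simp only [_root_.starMonomial, List.map_cons, List.prod_cons, Matrix.mul_apply]
      refine Finset.sum_congr rfl fun t _ => ?_
      split <;> simp
    rw [first_letter]
    refine .sum _ fun t _ => .mul ?_ (ih t)
    split
    · exact (hM _ _ _).star
    · exact hM _ _ _

end HasAllMoments

/-! ### The free `*`-algebra and a criterion for joint convergence -/

/-- The adjoint of a word in the letters `(i, ε)`, where `(i, true)` stands for the adjoint of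
`(i, false)`: the order of the letters is reversed and each letter is replaced by its adjoint. -/
def adjointWord {ι : Type*} (w : FreeMonoid (ι × Bool)) : FreeMonoid (ι × Bool) :=
  FreeMonoid.ofList ((w.toList.map fun l => (l.1, !l.2)).reverse)

theorem adjointWord_adjointWord {ι : Type*} (w : FreeMonoid (ι × Bool)) :
    adjointWord (adjointWord w) = w := by
  simp [adjointWord, List.map_reverse, Function.comp_def]

theorem adjointWord_mul {ι : Type*} (w z : FreeMonoid (ι × Bool)) :
    adjointWord (w * z) = adjointWord z * adjointWord w := by
  simp [adjointWord, FreeMonoid.toList_mul]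

theorem star_starMonomial {ι A : Type*} [Monoid A] [StarMul A] (x : ι → A) (w : List (ι × Bool)) :
    star (starMonomial x w) = starMonomial x ((w.map fun l => (l.1, !l.2)).reverse) := by
  induction w with
  | nil => simp [starMonomial]
  | cons l w ih =>
    simp only [starMonomial] at ih ⊢
    simp only [List.map_cons, List.prod_cons, star_mul, ih, List.reverse_cons, List.map_append,
      List.prod_append, List.map_nil, List.prod_nil, mul_one]
    congr 1
    cases l.2 <;> simp

/-- The free `*`-algebra over `ℂ` on the generators `ι`, realised as the algebra of the monoid of
words in the letters `(i, false)` (the generators) and `(i, true)` (their adjoints). -/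
abbrev FreeStarAlgebra (ι : Type*) := MonoidAlgebra ℂ (FreeMonoid (ι × Bool))

namespace FreeStarAlgebra

variable {ι : Type*}

/-- The involution of the free `*`-algebra as an additive map. -/
noncomputable def adjointHom (ι : Type*) : FreeStarAlgebra ι →+ FreeStarAlgebra ι :=
  (Finsupp.liftAddHom fun w => (MonoidAlgebra.singleAddHom (adjointWord w)).comp
    (starAddEquiv : ℂ ≃+ ℂ).toAddMonoidHom).comp MonoidAlgebra.coeffAddEquiv.toAddMonoidHom

theorem adjointHom_single (w : FreeMonoid (ι × Bool)) (c : ℂ) :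
    adjointHom ι (MonoidAlgebra.single w c) = MonoidAlgebra.single (adjointWord w) (star c) := by
  change (Finsupp.single w c).sum (fun v r => MonoidAlgebra.single (adjointWord v) (star r)) = _
  rw [Finsupp.sum_single_index (by simp)]

theorem adjointHom_adjointHom (f : FreeStarAlgebra ι) : adjointHom ι (adjointHom ι f) = f := by
  induction f using MonoidAlgebra.induction_linear with
  | zero => rw [map_zero, map_zero]
  | add f g hf hg => rw [map_add, map_add, hf, hg]
  | single w c => rw [adjointHom_single, adjointHom_single, adjointWord_adjointWord, star_star]

theorem adjointHom_mul (f g : FreeStarAlgebra ι) :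
    adjointHom ι (f * g) = adjointHom ι g * adjointHom ι f := by
  induction f using MonoidAlgebra.induction_linear with
  | zero => simp only [zero_mul, map_zero, mul_zero]
  | add f f' hf hf' => rw [add_mul, map_add, map_add, mul_add, hf, hf']
  | single w c =>
    induction g using MonoidAlgebra.induction_linear with
    | zero => simp only [mul_zero, map_zero, zero_mul]
    | add g g' hg hg' => rw [mul_add, map_add, map_add, add_mul, hg, hg']
    | single z d =>
      simp only [MonoidAlgebra.single_mul_single, adjointHom_single, adjointWord_mul, star_mul]

noncomputable instance : StarRing (FreeStarAlgebra ι) where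
  star := adjointHom ι
  star_involutive := adjointHom_adjointHom
  star_mul := adjointHom_mul
  star_add := map_add _

theorem star_single (w : FreeMonoid (ι × Bool)) (c : ℂ) :
    star (MonoidAlgebra.single w c : FreeStarAlgebra ι) =
      MonoidAlgebra.single (adjointWord w) (star c) := adjointHom_single w c

instance : StarModule ℂ (FreeStarAlgebra ι) where
  star_smul c f := by
    induction f using MonoidAlgebra.induction_linear with
    | zero => simp only [smul_zero, star_zero]
    | add f g hf hg => rw [smul_add, star_add, star_add, smul_add, hf, hg]
    | single w d => simp [star_single]

/-- The generators of the free `*`-algebra. -/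
noncomputable def gen (i : ι) : FreeStarAlgebra ι :=
  MonoidAlgebra.single (FreeMonoid.of (i, false)) 1

theorem starMonomial_gen (w : List (ι × Bool)) :
    starMonomial (gen (ι := ι)) w = MonoidAlgebra.single (FreeMonoid.ofList w) 1 := by
  induction w with
  | nil => rfl
  | cons l w ih =>
    have letter : (if l.2 then star (gen l.1) else gen l.1) =
        (MonoidAlgebra.single (FreeMonoid.of l) 1 : FreeStarAlgebra ι) := by
      obtain ⟨i, _ | _⟩ := l
      · rfl
      · simp only [if_true, gen, star_single, star_one]
        rfl
    rw [starMonomial] at ih ⊢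
    rw [List.map_cons, List.prod_cons, ih, letter, MonoidAlgebra.single_mul_single, one_mul,
      FreeMonoid.ofList_cons]

section Eval

variable {A : Type*} [Ring A] [StarRing A] [Algebra ℂ A] (x : ι → A)

/-- The evaluation of the elements of the free `*`-algebra at a family of elements of a
`*`-algebra. -/
noncomputable def eval : FreeStarAlgebra ι →ₐ[ℂ] A :=
  MonoidAlgebra.lift ℂ A _ (FreeMonoid.lift fun l => if l.2 then star (x l.1) else x l.1)

theorem eval_single (w : FreeMonoid (ι × Bool)) (c : ℂ) :
    eval x (MonoidAlgebra.single w c) = c • starMonomial x w.toList := by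
  simp [eval, MonoidAlgebra.lift_single, FreeMonoid.lift_apply, starMonomial]

theorem eval_star [StarModule ℂ A] (f : FreeStarAlgebra ι) :
    eval x (star f) = star (eval x f) := by
  induction f using MonoidAlgebra.induction_linear with
  | zero => simp only [star_zero, map_zero]
  | add f g hf hg => rw [star_add, map_add, map_add, star_add, hf, hg]
  | single w c =>
    rw [star_single, eval_single, eval_single, star_smul, star_starMonomial]
    rfl

end Eval

/-- The linear functional on the free `*`-algebra with prescribed values on the words. -/
noncomputable def functional (c : List (ι × Bool) → ℂ) : FreeStarAlgebra ι →ₗ[ℂ] ℂ :=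
  (Finsupp.linearCombination ℂ fun w => c w.toList).comp
    (MonoidAlgebra.coeffLinearEquiv ℂ).toLinearMap

theorem functional_single (c : List (ι × Bool) → ℂ) (w : FreeMonoid (ι × Bool)) (r : ℂ) :
    functional c (MonoidAlgebra.single w r) = r * c w.toList := by
  simp [functional, MonoidAlgebra.coeffLinearEquiv]

end FreeStarAlgebra

section Criterion

open scoped ComplexOrder

theorem traceState_mul_star_nonneg {Ω : Type*} [MeasurableSpace Ω] (μ : Measure Ω) {n : ℕ}
    (M : Ω → Matrix (Fin n) (Fin n) ℂ) : 0 ≤ traceState μ fun ω => M ω * star (M ω) := by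
  have trace_eq (ω : Ω) :
      (M ω * star (M ω)).trace = ((∑ i, ∑ j, ‖M ω i j‖ ^ 2 : ℝ) : ℂ) := by
    simp only [Matrix.trace, Matrix.diag, Matrix.mul_apply, Matrix.star_apply]
    push_cast
    simp [← Complex.mul_conj']
  simp only [traceState, trace_eq]
  rw [integral_complex_ofReal, ← Complex.ofReal_natCast, ← Complex.ofReal_inv,
    ← Complex.ofReal_mul, Complex.zero_le_real]
  exact mul_nonneg (by positivity) (integral_nonneg fun ω => by positivity)

variable {ι : Type*} {Ω : ℕ → Type*} [∀ n, MeasurableSpace (Ω n)] {μ : ∀ n, Measure (Ω n)}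
  {M : ι → ∀ n, Ω n → Matrix (Fin n) (Fin n) ℂ}

theorem tendsto_traceState_starMonomial_nil [∀ n, IsProbabilityMeasure (μ n)] :
    Tendsto (fun n => traceState (μ n) fun ω => starMonomial (fun i => M i n ω) [])
      atTop (𝓝 1) := by
  refine tendsto_const_nhds.congr' ?_
  filter_upwards [eventually_ne_atTop 0] with n hn
  simp [traceState, starMonomial, Nat.cast_ne_zero.2 hn]

theorem integrable_trace_eval [∀ n, IsFiniteMeasure (μ n)]
    (hM : ∀ i n r s, HasAllMoments (μ n) fun ω => M i n ω r s) (f : FreeStarAlgebra ι) (n : ℕ) :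
    Integrable (fun ω => (FreeStarAlgebra.eval (fun i => M i n ω) f).trace) (μ n) := by
  induction f using MonoidAlgebra.induction_linear with
  | zero => simp
  | add f g hf hg =>
    simp only [map_add, Matrix.trace_add]
    exact hf.add hg
  | single w r =>
    simp only [FreeStarAlgebra.eval_single, Matrix.trace_smul]
    refine (HasAllMoments.integrable ?_).fun_smul r
    exact .sum _ fun i _ => .starMonomial (fun i => hM i n) _ _ _

theorem tendsto_traceState_eval [∀ n, IsFiniteMeasure (μ n)]
    (hM : ∀ i n r s, HasAllMoments (μ n) fun ω => M i n ω r s) {c : List (ι × Bool) → ℂ}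
    (hc : ∀ w, Tendsto (fun n => traceState (μ n) fun ω => starMonomial (fun i => M i n ω) w)
      atTop (𝓝 (c w))) (f : FreeStarAlgebra ι) :
    Tendsto (fun n => traceState (μ n) fun ω => FreeStarAlgebra.eval (fun i => M i n ω) f) atTop
      (𝓝 (FreeStarAlgebra.functional c f)) := by
  induction f using MonoidAlgebra.induction_linear with
  | zero => simp [traceState]
  | add f g hf hg =>
    rw [map_add]
    refine (hf.add hg).congr fun n => ?_
    simp only [traceState, map_add, Matrix.trace_add, ← mul_add]
    rw [integral_add (integrable_trace_eval hM f n) (integrable_trace_eval hM g n)]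
  | single w r =>
    rw [FreeStarAlgebra.functional_single]
    refine ((hc w.toList).const_mul r).congr fun n => ?_
    simp only [traceState, FreeStarAlgebra.eval_single, Matrix.trace_smul, smul_eq_mul,
      integral_const_mul]
    ring

theorem convergeJointly_of_forall_tendsto {ι : Type} [∀ n, IsProbabilityMeasure (μ n)]
    {M : ι → ∀ n, Ω n → Matrix (Fin n) (Fin n) ℂ}
    (hM : ∀ i n r s, HasAllMoments (μ n) fun ω => M i n ω r s)
    (hlim : ∀ w : List (ι × Bool), w ≠ [] → ∃ c : ℂ, Tendsto
      (fun n => traceState (μ n) fun ω => starMonomial (fun i => M i n ω) w) atTop (𝓝 c)) :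
    ConvergeJointly μ M := by
  have hlim' (w : List (ι × Bool)) : ∃ c : ℂ, Tendsto
      (fun n => traceState (μ n) fun ω => starMonomial (fun i => M i n ω) w) atTop (𝓝 c) := by
    rcases eq_or_ne w [] with rfl | hw
    · exact ⟨1, tendsto_traceState_starMonomial_nil⟩
    · exact hlim w hw
  choose c hc using hlim'
  refine ⟨FreeStarAlgebra ι, inferInstance, inferInstance, inferInstance, inferInstance,
    ⟨FreeStarAlgebra.functional c, ?_, fun f => ?_⟩, FreeStarAlgebra.gen,
    fun i n r s => hM i n r s, fun w _ => ?_⟩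
  · rw [MonoidAlgebra.one_def, FreeStarAlgebra.functional_single, one_mul]
    exact tendsto_nhds_unique (hc []) tendsto_traceState_starMonomial_nil
  · refine ge_of_tendsto' (tendsto_traceState_eval hM hc (f * star f)) fun n => ?_
    simp only [map_mul, FreeStarAlgebra.eval_star]
    exact traceState_mul_star_nonneg _ _
  · rw [FreeStarAlgebra.starMonomial_gen, FreeStarAlgebra.functional_single, one_mul]
    exact hc w

end Criterion

/-! ### Lattice sums as integrals -/

section LatticeSums

variable {V : Type*} [DecidableEq V]

/-- The scaling factor of a coordinate: `n` for the coordinates in `S`, and `1` for the others. -/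
def latticeScale (S : Finset V) (n : ℕ) (v : V) : ℝ :=
  if v ∈ S then n else 1

/-- The lattice point below the point `x`, scaled by `n` in the coordinates in `S`. -/
noncomputable def latticePoint (S : Finset V) (n : ℕ) (x : V → ℝ) (v : V) : ℤ :=
  ⌊latticeScale S n v * x v⌋

theorem latticePoint_of_mem {S : Finset V} {v : V} (hv : v ∈ S) (n : ℕ) (x : V → ℝ) :
    latticePoint S n x v = ⌊n * x v⌋ := by
  simp only [latticePoint, latticeScale, hv, if_true]

theorem latticePoint_of_notMem {S : Finset V} {v : V} (hv : v ∉ S) (n : ℕ) (x : V → ℝ) :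
    latticePoint S n x v = ⌊x v⌋ := by
  simp only [latticePoint, latticeScale, hv, if_false, one_mul]

theorem latticeScale_pos (S : Finset V) {n : ℕ} (hn : 1 ≤ n) (v : V) : 0 < latticeScale S n v := by
  unfold latticeScale
  split
  · exact_mod_cast hn
  · exact one_pos

theorem measurable_latticePoint (S : Finset V) (n : ℕ) : Measurable (latticePoint S n) :=
  measurable_pi_lambda _ fun v => Int.measurable_floor.comp
    ((measurable_pi_apply v).const_mul _)

theorem floor_mul_eq_iff {a : ℝ} (ha : 0 < a) (x : ℝ) (k : ℤ) :
    ⌊a * x⌋ = k ↔ x ∈ Set.Ico (k / a) ((k + 1) / a) := by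
  rw [Int.floor_eq_iff, Set.mem_Ico, div_le_iff₀ ha, lt_div_iff₀ ha, mul_comm x]

theorem integral_floor_mul_eq {a : ℝ} (ha : 0 < a) (k : ℤ) :
    ∫ x : ℝ, (if ⌊a * x⌋ = k then (1 : ℂ) else 0) = ((a⁻¹ : ℝ) : ℂ) := by
  have indicator_eq : (fun x : ℝ => if ⌊a * x⌋ = k then (1 : ℂ) else 0) =
      (Set.Ico (k / a) ((k + 1) / a)).indicator fun _ => 1 := by
    funext x
    simp only [Set.indicator, floor_mul_eq_iff ha]
  have length_eq : (k + 1) / a - k / a = a⁻¹ := by ring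
  rw [indicator_eq, integral_indicator measurableSet_Ico, setIntegral_const, measureReal_def,
    Real.volume_Ico, length_eq, ENNReal.toReal_ofReal (inv_nonneg.2 ha.le), Complex.real_smul,
    mul_one]

theorem integrable_floor_mul_eq {a : ℝ} (ha : 0 < a) (k : ℤ) :
    Integrable (fun x : ℝ => if ⌊a * x⌋ = k then (1 : ℂ) else 0) := by
  refine not_imp_comm.1 integral_undef ?_
  rw [integral_floor_mul_eq ha]
  exact_mod_cast inv_ne_zero ha.ne'

theorem integrable_comp_floor {g : ℤ → ℝ} (hg : Summable g) (h0 : ∀ k, 0 ≤ g k) :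
    Integrable fun x : ℝ => g ⌊x⌋ := by
  rw [← integrableOn_univ, ← iUnion_Ico_intCast ℝ]
  have floor_const (k : ℤ) :
      Set.EqOn (fun x : ℝ => g ⌊x⌋) (fun _ => g k) (Set.Ico (k : ℝ) (k + 1)) :=
    fun x hx => congrArg g (Int.floor_eq_iff.2 hx)
  refine integrableOn_iUnion_of_summable_integral_norm (fun k => ?_) ?_
  · rw [integrableOn_congr_fun (floor_const k) measurableSet_Ico]
    exact integrableOn_const (by simp)
  · refine hg.congr fun k => ?_
    rw [setIntegral_congr_fun (g := fun _ => g k) measurableSet_Ico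
      fun x hx => by simp only [floor_const k hx, Real.norm_eq_abs, abs_of_nonneg (h0 k)]]
    simp [measureReal_def]

variable [Fintype V]

/-- The lattice points with coordinates between `-n` and `n`. -/
noncomputable def latticeBox (V : Type*) [Fintype V] [DecidableEq V] (n : ℕ) : Finset (V → ℤ) :=
  Fintype.piFinset fun _ => Finset.Icc (-n : ℤ) n

theorem prod_latticeScale (S : Finset V) (n : ℕ) : ∏ v, latticeScale S n v = (n : ℝ) ^ S.card := by
  simp [latticeScale, Finset.prod_ite_mem]

theorem sum_eq_integral_latticePoint (S : Finset V) {n : ℕ} (hn : 1 ≤ n)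
    (s : Finset (V → ℤ)) (f : (V → ℤ) → ℂ) (hf : ∀ u, u ∉ s → f u = 0) :
    ∑ u ∈ s, f u = (n : ℂ) ^ S.card * ∫ x, f (latticePoint S n x) := by
  have hpos := latticeScale_pos S hn
  have indicator_eq (x : V → ℝ) (u : V → ℤ) :
      (∏ v, if ⌊latticeScale S n v * x v⌋ = u v then (1 : ℂ) else 0) =
        if latticePoint S n x = u then 1 else 0 := by
    rw [Finset.prod_ite_zero]
    simp [funext_iff, latticePoint]
  have expansion (x : V → ℝ) : f (latticePoint S n x) =
      ∑ u ∈ s, f u * ∏ v, if ⌊latticeScale S n v * x v⌋ = u v then (1 : ℂ) else 0 := by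
    simp only [indicator_eq, mul_ite, mul_one, mul_zero, Finset.sum_ite_eq]
    split_ifs with h
    · rfl
    · exact hf _ h
  have cell_integrable (u : V → ℤ) : Integrable fun x : V → ℝ =>
      ∏ v, if ⌊latticeScale S n v * x v⌋ = u v then (1 : ℂ) else 0 :=
    Integrable.fintype_prod (f := fun v (t : ℝ) =>
      if ⌊latticeScale S n v * t⌋ = u v then (1 : ℂ) else 0)
      fun v => integrable_floor_mul_eq (hpos v) _
  have cell_integral (u : V → ℤ) :
      ∫ x : V → ℝ, ∏ v, (if ⌊latticeScale S n v * x v⌋ = u v then (1 : ℂ) else 0) =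
        ((n : ℂ) ^ S.card)⁻¹ := by
    rw [integral_fintype_prod_volume_eq_prod fun v (t : ℝ) =>
      if ⌊latticeScale S n v * t⌋ = u v then (1 : ℂ) else 0]
    simp only [integral_floor_mul_eq (hpos _)]
    rw [← Complex.ofReal_prod, Finset.prod_inv_distrib, prod_latticeScale]
    push_cast
    rfl
  have hn' : (n : ℂ) ^ S.card ≠ 0 := pow_ne_zero _ (Nat.cast_ne_zero.2 (by omega))
  simp only [expansion]
  rw [integral_finsetSum _ fun u _ => (cell_integrable u).const_mul _]
  simp only [integral_const_mul, cell_integral]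
  rw [← Finset.sum_mul, mul_comm, inv_mul_cancel_right₀ hn']

/-- A function of `x` that dominates, for every `n`, a function supported in `latticeBox V n` and
bounded by `∏ v ∉ S, g v (u v)`, evaluated at the lattice point below `x`. -/
noncomputable def latticeMajorant (S : Finset V) (g : V → ℤ → ℝ) (x : V → ℝ) : ℝ :=
  ∏ v, if v ∈ S then (Set.Icc (-1) 2).indicator 1 (x v) else g v ⌊x v⌋

theorem integrable_latticeMajorant {S : Finset V} {g : V → ℤ → ℝ}
    (hg : ∀ v, v ∉ S → Summable (g v)) (h0 : ∀ v k, 0 ≤ g v k) :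
    Integrable (latticeMajorant S g) := by
  refine Integrable.fintype_prod
    (f := fun v t => if v ∈ S then (Set.Icc (-1) 2).indicator 1 t else g v ⌊t⌋) fun v => ?_
  split_ifs with hv
  · exact (integrable_indicator_iff measurableSet_Icc).2 (integrableOn_const (by simp))
  · exact integrable_comp_floor (hg v hv) (h0 v)

theorem latticeMajorant_nonneg (S : Finset V) {g : V → ℤ → ℝ} (h0 : ∀ v k, 0 ≤ g v k)
    (x : V → ℝ) : 0 ≤ latticeMajorant S g x := by
  refine Finset.prod_nonneg fun v _ => ?_
  split
  · exact Set.indicator_nonneg (fun _ _ => zero_le_one) _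
  · exact h0 _ _

theorem mem_Icc_of_latticePoint_mem_latticeBox {S : Finset V} {n : ℕ} (hn : 1 ≤ n) {x : V → ℝ}
    (hx : latticePoint S n x ∈ latticeBox V n) {v : V} (hv : v ∈ S) :
    x v ∈ Set.Icc (-1 : ℝ) 2 := by
  obtain ⟨lower, upper⟩ := Finset.mem_Icc.1 (Fintype.mem_piFinset.1 hx v)
  rw [latticePoint_of_mem hv] at lower upper
  have hn' : (1 : ℝ) ≤ n := by exact_mod_cast hn
  have h1 : -(n : ℝ) ≤ n * x v := by exact_mod_cast Int.le_floor.1 lower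
  have h2 : n * x v < n + 1 := by exact_mod_cast Int.floor_lt.1 (Int.lt_add_one_of_le upper)
  constructor <;> nlinarith

theorem latticeMajorant_eq_prod {S : Finset V} (g : V → ℤ → ℝ) {n : ℕ} (hn : 1 ≤ n) {x : V → ℝ}
    (hx : latticePoint S n x ∈ latticeBox V n) :
    latticeMajorant S g x = ∏ v ∈ Sᶜ, g v (latticePoint S n x v) := by
  rw [latticeMajorant, ← Finset.prod_mul_prod_compl S, Finset.prod_eq_one, one_mul]
  · refine Finset.prod_congr rfl fun v hv => ?_
    have hv' := Finset.mem_compl.1 hv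
    rw [if_neg hv', latticePoint_of_notMem hv']
  · intro v hv
    rw [if_pos hv, Set.indicator_of_mem (mem_Icc_of_latticePoint_mem_latticeBox hn hx hv),
      Pi.one_apply]

theorem exists_tendsto_sum_latticeBox (S : Finset V) (F : ℕ → (V → ℤ) → ℂ) {g : V → ℤ → ℝ}
    (hg : ∀ v, v ∉ S → Summable (g v)) (h0 : ∀ v k, 0 ≤ g v k) {K : ℝ} (hK : 0 ≤ K)
    (hbox : ∀ n u, u ∉ latticeBox V n → F n u = 0)
    (hbound : ∀ n, 1 ≤ n → ∀ u, ‖F n u‖ ≤ K * ∏ v ∈ Sᶜ, g v (u v))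
    (hlim : ∀ᵐ x : V → ℝ, ∃ c, Tendsto (fun n => F n (latticePoint S n x)) atTop (𝓝 c)) :
    ∃ c, Tendsto (fun n : ℕ => ((n : ℂ) ^ S.card)⁻¹ * ∑ u ∈ latticeBox V n, F n u)
      atTop (𝓝 c) := by
  have tendsto_integral := tendsto_integral_filter_of_dominated_convergence (μ := volume)
    (l := atTop) (F := fun n x => F n (latticePoint S n x))
    (f := fun x => limUnder atTop fun n => F n (latticePoint S n x))
    (fun x => K * latticeMajorant S g x)
    (.of_forall fun n =>
      ((measurable_of_countable (F n)).comp (measurable_latticePoint S n)).aestronglyMeasurable)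
    ?_ ((integrable_latticeMajorant hg h0).const_mul K)
    (hlim.mono fun x hx => tendsto_nhds_limUnder hx)
  · refine ⟨_, tendsto_integral.congr' ?_⟩
    filter_upwards [eventually_ge_atTop 1] with n hn
    rw [sum_eq_integral_latticePoint S hn _ _ (hbox n), inv_mul_cancel_left₀]
    exact pow_ne_zero _ (Nat.cast_ne_zero.2 (by omega))
  · filter_upwards [eventually_ge_atTop 1] with n hn
    refine .of_forall fun x => ?_
    by_cases hx : latticePoint S n x ∈ latticeBox V n
    · exact (hbound n hn _).trans_eq (by rw [latticeMajorant_eq_prod g hn hx])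
    · rw [hbox n _ hx, norm_zero]
      exact mul_nonneg hK (latticeMajorant_nonneg S h0 x)

end LatticeSums

/-! ### Integer affine forms at lattice points -/

theorem eventuallyConst_pi {ι κ β : Type*} [Finite κ] [Nonempty β] {l : Filter ι} {f : κ → ι → β}
    (hf : ∀ k, EventuallyConst (f k) l) : EventuallyConst (fun i k => f k i) l := by
  simp only [eventuallyConst_iff_exists_eventuallyEq] at hf ⊢
  choose c hc using hf
  exact ⟨c, (eventually_all.2 hc).mono fun i hi => funext hi⟩

section Affine

variable {V : Type*} [Fintype V]

/-- A function of `n` and of a lattice point that is affine with integer coefficients. -/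
def IsIntAffine (f : ℕ → (V → ℤ) → ℤ) : Prop :=
  ∃ (A : V → ℤ) (d e : ℤ), ∀ n u, f n u = ∑ v, A v * u v + d * n + e

namespace IsIntAffine

variable {f g : ℕ → (V → ℤ) → ℤ}

theorem coord (v : V) : IsIntAffine fun _ u => u v := by
  classical exact ⟨Pi.single v 1, 0, 0, fun n u => by simp [Pi.single_apply]⟩

theorem const (e : ℤ) : IsIntAffine fun _ (_ : V → ℤ) => e :=
  ⟨0, 0, e, fun n u => by simp⟩

theorem size : IsIntAffine fun n (_ : V → ℤ) => (n : ℤ) :=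
  ⟨0, 1, 0, fun n u => by simp⟩

theorem add (hf : IsIntAffine f) (hg : IsIntAffine g) :
    IsIntAffine fun n u => f n u + g n u := by
  obtain ⟨A, d, e, h⟩ := hf
  obtain ⟨A', d', e', h'⟩ := hg
  refine ⟨A + A', d + d', e + e', fun n u => ?_⟩
  simp only [h, h', Pi.add_apply, add_mul, Finset.sum_add_distrib]
  ring

theorem neg (hf : IsIntAffine f) : IsIntAffine fun n u => -f n u := by
  obtain ⟨A, d, e, h⟩ := hf
  refine ⟨-A, -d, -e, fun n u => ?_⟩
  simp only [h, Pi.neg_apply, neg_mul, Finset.sum_neg_distrib]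
  ring

theorem sub (hf : IsIntAffine f) (hg : IsIntAffine g) : IsIntAffine fun n u => f n u - g n u := by
  simpa only [sub_eq_add_neg] using hf.add hg.neg

end IsIntAffine

theorem tendsto_floor_nat_mul_div (x : ℝ) :
    Tendsto (fun n : ℕ => (⌊(n : ℝ) * x⌋ : ℝ) / n) atTop (𝓝 x) := by
  have lower : Tendsto (fun n : ℕ => x - 1 / (n : ℝ)) atTop (𝓝 x) := by
    simpa using tendsto_const_nhds.sub (tendsto_const_div_atTop_nhds_zero_nat (1 : ℝ))
  refine tendsto_of_tendsto_of_tendsto_of_le_of_le' lower tendsto_const_nhds ?_ ?_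
  · filter_upwards [eventually_gt_atTop 0] with n hn
    have hn' : (0 : ℝ) < n := by exact_mod_cast hn
    rw [le_div_iff₀ hn', sub_mul, div_mul_cancel₀ _ hn'.ne', mul_comm]
    exact (Int.sub_one_lt_floor _).le
  · filter_upwards [eventually_gt_atTop 0] with n hn
    have hn' : (0 : ℝ) < n := by exact_mod_cast hn
    rw [div_le_iff₀ hn', mul_comm x]
    exact Int.floor_le _

theorem eventuallyConst_nonneg_mul_natCast_add (d e : ℤ) :
    EventuallyConst (fun n : ℕ => 0 ≤ d * n + e) atTop := by
  rw [eventuallyConst_pred]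
  rcases lt_trichotomy d 0 with hd | rfl | hd
  · right
    filter_upwards [eventually_gt_atTop e.toNat] with n hn
    have : e < n := by omega
    nlinarith
  · simp only [zero_mul, zero_add]
    exact (le_or_gt 0 e).imp (fun h => .of_forall fun _ => h) fun h => .of_forall fun _ => h.not_ge
  · left
    filter_upwards [eventually_gt_atTop (-e).toNat] with n hn
    have : -e < n := by omega
    nlinarith

theorem eventuallyConst_nonneg_of_tendsto_div {f : ℕ → ℤ} {c : ℝ}
    (hf : Tendsto (fun n => (f n : ℝ) / n) atTop (𝓝 c)) (hc : c ≠ 0) :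
    EventuallyConst (fun n => 0 ≤ f n) atTop := by
  rw [eventuallyConst_pred]
  rcases hc.lt_or_gt with h | h
  · right
    filter_upwards [hf.eventually_lt_const h, eventually_gt_atTop 0] with n hn hn0
    rw [div_lt_iff₀ (Nat.cast_pos.2 hn0), zero_mul] at hn
    exact not_le.2 (by exact_mod_cast hn)
  · left
    filter_upwards [hf.eventually_const_lt h, eventually_gt_atTop 0] with n hn hn0
    rw [lt_div_iff₀ (Nat.cast_pos.2 hn0), zero_mul] at hn
    exact_mod_cast hn.le

theorem ae_affine_ne_zero {S : Finset V} {A : V → ℝ} {v : V} (hv : v ∈ S) (hA : A v ≠ 0) (d : ℝ) :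
    ∀ᵐ x : V → ℝ, ∑ w ∈ S, A w * x w + d ≠ 0 := by
  classical
  let ℓ : (V → ℝ) →ₗ[ℝ] ℝ := ∑ w ∈ S, A w • LinearMap.proj w
  let hyperplane : AffineSubspace ℝ (V → ℝ) :=
    (AffineSubspace.mk' (-d) ⊥).comap ℓ.toAffineMap
  have mem_hyperplane (x : V → ℝ) : x ∈ hyperplane ↔ ∑ w ∈ S, A w * x w + d = 0 := by
    simp [hyperplane, ℓ, AffineSubspace.mem_mk']
  have hyperplane_ne_top : hyperplane ≠ ⊤ := by
    intro htop
    have h0 := (mem_hyperplane 0).1 (htop ▸ AffineSubspace.mem_top ℝ _ _)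
    have h1 := (mem_hyperplane (Pi.single v 1)).1 (htop ▸ AffineSubspace.mem_top ℝ _ _)
    simp only [Pi.zero_apply, mul_zero, Finset.sum_const_zero, zero_add] at h0
    simp only [Pi.single_apply, mul_ite, mul_one, mul_zero, Finset.sum_ite_eq', hv, if_true, h0,
      add_zero] at h1
    exact hA h1
  filter_upwards [measure_eq_zero_iff_ae_notMem.1
    (Measure.addHaar_affineSubspace volume hyperplane hyperplane_ne_top)] with x hx
  exact fun h => hx ((mem_hyperplane x).2 h)

variable [DecidableEq V]

theorem tendsto_affine_latticePoint_div (S : Finset V) (A : V → ℤ) (d e : ℤ) (x : V → ℝ) :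
    Tendsto (fun n : ℕ => ((∑ v, A v * latticePoint S n x v + d * n + e : ℤ) : ℝ) / n) atTop
      (𝓝 (∑ v ∈ S, (A v : ℝ) * x v + d)) := by
  have tendsto_coord (v : V) : Tendsto (fun n : ℕ => (A v : ℝ) * latticePoint S n x v / n) atTop
      (𝓝 (if v ∈ S then A v * x v else 0)) := by
    split_ifs with hv
    · simp only [latticePoint_of_mem hv, mul_div_assoc]
      exact (tendsto_floor_nat_mul_div (x v)).const_mul _
    · simp only [latticePoint_of_notMem hv]
      exact tendsto_const_div_atTop_nhds_zero_nat _
  have tendsto_sum := ((tendsto_finsetSum Finset.univ fun v _ => tendsto_coord v).add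
    (tendsto_const_nhds (x := (d : ℝ)))).add (tendsto_const_div_atTop_nhds_zero_nat (e : ℝ))
  rw [add_zero, Finset.sum_ite_mem, Finset.univ_inter] at tendsto_sum
  refine tendsto_sum.congr' ?_
  filter_upwards [eventually_ne_atTop 0] with n hn
  push_cast
  rw [add_div, add_div, Finset.sum_div, mul_div_cancel_right₀ _ (Nat.cast_ne_zero.2 hn)]

theorem ae_eventuallyConst_affine_nonneg (S : Finset V) (A : V → ℤ) (d e : ℤ) :
    ∀ᵐ x : V → ℝ, EventuallyConst (fun n : ℕ =>
      0 ≤ ∑ v, A v * latticePoint S n x v + d * n + e) atTop := by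
  by_cases hA : ∀ v ∈ S, A v = 0
  · refine .of_forall fun x => ?_
    have sum_const (n : ℕ) : ∑ v, A v * latticePoint S n x v = ∑ v, A v * ⌊x v⌋ := by
      refine Finset.sum_congr rfl fun v _ => ?_
      by_cases hv : v ∈ S
      · rw [hA v hv, zero_mul, zero_mul]
      · rw [latticePoint_of_notMem hv]
    simp only [sum_const, add_comm (∑ v, A v * ⌊x v⌋), add_assoc]
    exact eventuallyConst_nonneg_mul_natCast_add d _
  · push Not at hA
    obtain ⟨v, hv, hne⟩ := hA
    filter_upwards [ae_affine_ne_zero (A := fun v => (A v : ℝ)) hv (Int.cast_ne_zero.2 hne) d]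
      with x hx
    exact eventuallyConst_nonneg_of_tendsto_div (tendsto_affine_latticePoint_div S A d e x) hx

/-- A point at whose lattice points every integer affine form is eventually nonnegative or
eventually negative. -/
def IsAffinelyGeneric (S : Finset V) (x : V → ℝ) : Prop :=
  ∀ f : ℕ → (V → ℤ) → ℤ, IsIntAffine f →
    EventuallyConst (fun n => 0 ≤ f n (latticePoint S n x)) atTop

theorem ae_isAffinelyGeneric (S : Finset V) : ∀ᵐ x : V → ℝ, IsAffinelyGeneric S x := by
  have forms : ∀ᵐ x : V → ℝ, ∀ p : (V → ℤ) × ℤ × ℤ, EventuallyConst (fun n : ℕ =>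
      0 ≤ ∑ v, p.1 v * latticePoint S n x v + p.2.1 * n + p.2.2) atTop :=
    ae_all_iff.2 fun p => ae_eventuallyConst_affine_nonneg S p.1 p.2.1 p.2.2
  filter_upwards [forms] with x hx f ⟨A, d, e, hf⟩
  simpa only [hf] using hx (A, d, e)

namespace IsAffinelyGeneric

variable {S : Finset V} {x : V → ℝ} {f g : ℕ → (V → ℤ) → ℤ}

theorem eventuallyConst_le (hx : IsAffinelyGeneric S x) (hf : IsIntAffine f) (hg : IsIntAffine g) :
    EventuallyConst (fun n => f n (latticePoint S n x) ≤ g n (latticePoint S n x)) atTop := by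
  simpa only [sub_nonneg] using hx _ (hg.sub hf)

theorem eventuallyConst_lt (hx : IsAffinelyGeneric S x) (hf : IsIntAffine f) (hg : IsIntAffine g) :
    EventuallyConst (fun n => f n (latticePoint S n x) < g n (latticePoint S n x)) atTop := by
  simpa only [Function.comp_def, not_le] using (hx.eventuallyConst_le hg hf).comp Not

theorem eventuallyConst_eq (hx : IsAffinelyGeneric S x) (hf : IsIntAffine f) (hg : IsIntAffine g) :
    EventuallyConst (fun n => f n (latticePoint S n x) = g n (latticePoint S n x)) atTop := by
  simpa only [le_antisymm_iff] using
    (hx.eventuallyConst_le hf hg).comp₂ And (hx.eventuallyConst_le hg hf)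

end IsAffinelyGeneric

end Affine

/-! ### Traces of products as sums over closed paths -/

section MatrixPaths

variable {ι R : Type*} [Fintype ι] [DecidableEq ι] [CommSemiring R] {L : ℕ}

theorem prod_ofFn_apply_eq_sum_paths (M : Fin L → Matrix ι ι R) (i j : ι) :
    (List.ofFn M).prod i j = ∑ p : Fin (L + 1) → ι,
      if p 0 = i ∧ p (Fin.last L) = j then ∏ l, M l (p l.castSucc) (p l.succ) else 0 := by
  induction L generalizing i with
  | zero =>
    rw [← (Equiv.funUnique (Fin 1) ι).symm.sum_comp, Finset.sum_eq_single i]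
    · simp [Matrix.one_apply]
    · intro b _ hb
      simp [hb]
    · simp
  | succ L ih =>
    have remove_start (a : ι) (p : Fin (L + 1) → ι) :
        (if (Fin.cons a p : Fin (L + 2) → ι) 0 = i ∧
            (Fin.cons a p : Fin (L + 2) → ι) (Fin.last (L + 1)) = j then
          ∏ l : Fin (L + 1), M l ((Fin.cons a p : Fin (L + 2) → ι) l.castSucc)
            ((Fin.cons a p : Fin (L + 2) → ι) l.succ) else 0) =
        if a = i then M 0 a (p 0) * (if p (Fin.last L) = j then
          ∏ l : Fin L, M l.succ (p l.castSucc) (p l.succ) else 0) else 0 := by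
      rw [← Fin.succ_last, Fin.prod_univ_succ]
      simp only [Fin.cons_zero, Fin.cons_succ, Fin.castSucc_zero, ← Fin.succ_castSucc, mul_ite,
        mul_zero, ite_and]
    rw [List.ofFn_succ, List.prod_cons, Matrix.mul_apply, ← (Fin.consEquiv fun _ => ι).sum_comp,
      Fintype.sum_prod_type]
    simp only [Fin.consEquiv_apply, remove_start, Finset.sum_ite_irrel, Finset.sum_const_zero,
      Finset.sum_ite_eq', Finset.mem_univ, if_true, ih, Finset.mul_sum]
    rw [Finset.sum_comm]
    refine Finset.sum_congr rfl fun p _ => ?_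
    simp only [ite_and, mul_ite, mul_zero, Finset.sum_ite_eq, Finset.mem_univ, if_true]

theorem trace_prod_ofFn_eq_sum_paths (M : Fin L → Matrix ι ι R) :
    (List.ofFn M).prod.trace = ∑ p : Fin (L + 1) → ι,
      if p 0 = p (Fin.last L) then ∏ l, M l (p l.castSucc) (p l.succ) else 0 := by
  simp only [Matrix.trace, Matrix.diag, prod_ofFn_apply_eq_sum_paths]
  rw [Finset.sum_comm]
  refine Finset.sum_congr rfl fun p _ => ?_
  simp only [ite_and, Finset.sum_ite_eq, Finset.mem_univ, if_true]
  exact if_congr eq_comm rfl rfl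

end MatrixPaths

/-- A letter of a word in the matrices of the family and their adjoints. -/
abbrev Letter (m : ℕ) := MatrixLabel m × Bool

section Paths

variable {m L : ℕ}

/-- The index of the input in the entry `(p, q)` of the matrix of a letter. The backward identity
has the entries of a Hankel matrix with input `δ₀`. -/
def stepIndex (n : ℕ) : Letter m → ℤ → ℤ → ℤ
  | (.perm, _), p, q => n - 1 - p - q
  | (_, false), p, q => p - q
  | (_, true), p, q => q - p

/-- The column in which the matrix of a letter has the input with index `u` in the row `p`. -/
def nextPosition (n : ℕ) : Letter m → ℤ → ℤ → ℤ
  | (.perm, _), p, u => n - 1 - p - u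
  | (_, false), p, u => p - u
  | (_, true), p, u => p + u

theorem nextPosition_stepIndex (n : ℕ) (x : Letter m) (p q : ℤ) :
    nextPosition n x p (stepIndex n x p q) = q := by
  obtain ⟨_ | _ | _, _ | _⟩ := x <;> simp [nextPosition, stepIndex]

theorem stepIndex_nextPosition (n : ℕ) (x : Letter m) (p u : ℤ) :
    stepIndex n x p (nextPosition n x p u) = u := by
  obtain ⟨_ | _ | _, _ | _⟩ := x <;> simp [nextPosition, stepIndex]

theorem stepIndex_mem_Icc {n : ℕ} (x : Letter m) {p q : ℤ} (hp : 0 ≤ p ∧ p < n)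
    (hq : 0 ≤ q ∧ q < n) : stepIndex n x p q ∈ Finset.Icc (-n : ℤ) n := by
  rw [Finset.mem_Icc]
  obtain ⟨_ | _ | _, _ | _⟩ := x <;> simp only [stepIndex] <;> omega

/-- The starting point of a path together with the indices of the inputs along the path. -/
def pathInputs (n : ℕ) (x : Fin L → Letter m) (q : Fin (L + 1) → ℤ) : Option (Fin L) → ℤ
  | none => q 0
  | some l => stepIndex n (x l) (q l.castSucc) (q l.succ)

/-- The path with starting point `y none` whose `l`-th step uses the input with index
`y (some l)`. -/
def latticePath (n : ℕ) (x : Fin L → Letter m) (y : Option (Fin L) → ℤ) : Fin (L + 1) → ℤ :=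
  Fin.induction (y none) fun l p => nextPosition n (x l) p (y (some l))

theorem latticePath_succ (n : ℕ) (x : Fin L → Letter m) (y : Option (Fin L) → ℤ) (l : Fin L) :
    latticePath n x y l.succ = nextPosition n (x l) (latticePath n x y l.castSucc) (y (some l)) :=
  Fin.induction_succ ..

theorem latticePath_pathInputs (n : ℕ) (x : Fin L → Letter m) (q : Fin (L + 1) → ℤ) :
    latticePath n x (pathInputs n x q) = q := by
  funext l
  induction l using Fin.induction with
  | zero => rfl
  | succ l ih => rw [latticePath_succ, ih, pathInputs, nextPosition_stepIndex]

theorem pathInputs_latticePath (n : ℕ) (x : Fin L → Letter m) (y : Option (Fin L) → ℤ) :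
    pathInputs n x (latticePath n x y) = y := by
  funext o
  cases o with
  | none => rfl
  | some l => rw [pathInputs, latticePath_succ, stepIndex_nextPosition]

/-- The closed paths in the index set `{0, …, n - 1}` of the matrices. -/
def IsClosedPath (n : ℕ) (q : Fin (L + 1) → ℤ) : Prop :=
  (∀ l, 0 ≤ q l ∧ q l < n) ∧ q 0 = q (Fin.last L)

theorem IsClosedPath.pathInputs_mem_latticeBox {n : ℕ} {q : Fin (L + 1) → ℤ}
    (hq : IsClosedPath n q) (x : Fin L → Letter m) :
    pathInputs n x q ∈ latticeBox (Option (Fin L)) n := by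
  refine Fintype.mem_piFinset.2 fun o => ?_
  cases o with
  | none =>
    have := hq.1 0
    rw [pathInputs, Finset.mem_Icc]
    omega
  | some l => exact stepIndex_mem_Icc _ (hq.1 _) (hq.1 _)

open Classical in
theorem sum_closedPaths_eq_sum_latticeBox {M : Type*} [AddCommMonoid M] (n : ℕ)
    (x : Fin L → Letter m) (H : (Fin (L + 1) → ℤ) → M) :
    ∑ p : Fin (L + 1) → Fin n, (if p 0 = p (Fin.last L) then H (fun l => p l) else 0) =
      ∑ y ∈ latticeBox (Option (Fin L)) n,
        if IsClosedPath n (latticePath n x y) then H (latticePath n x y) else 0 := by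
  have isClosedPath_coe (p : Fin (L + 1) → Fin n) (hp : p 0 = p (Fin.last L)) :
      IsClosedPath n fun l => ((p l : ℕ) : ℤ) :=
    ⟨fun l => ⟨Int.natCast_nonneg _, Int.ofNat_lt.2 (p l).2⟩,
      congrArg (fun i : Fin n => (i : ℤ)) hp⟩
  rw [← Finset.sum_filter, ← Finset.sum_filter]
  refine Finset.sum_bij (fun p _ => pathInputs n x fun l => ((p l : ℕ) : ℤ)) (fun p hp => ?_)
    (fun p _ p' _ h => ?_) (fun y hy => ?_) (fun p _ => by rw [latticePath_pathInputs])
  · have hq := isClosedPath_coe p (Finset.mem_filter.1 hp).2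
    rw [Finset.mem_filter, latticePath_pathInputs]
    exact ⟨hq.pathInputs_mem_latticeBox x, hq⟩
  · have := congrArg (latticePath n x) h
    rw [latticePath_pathInputs, latticePath_pathInputs] at this
    exact funext fun l => Fin.ext (by exact_mod_cast congrFun this l)
  · obtain ⟨range, closed⟩ := (Finset.mem_filter.1 hy).2
    lift latticePath n x y to Fin (L + 1) → ℕ using fun l => (range l).1 with q hq
    refine ⟨fun l => ⟨q l, by exact_mod_cast (range l).2⟩, ?_, ?_⟩
    · rw [Finset.mem_filter]
      exact ⟨Finset.mem_univ _, Fin.ext (by exact_mod_cast closed)⟩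
    · exact (congrArg (pathInputs n x) hq).trans (pathInputs_latticePath n x y)

end Paths

/-! ### Coincidence patterns of random inputs -/

section Patterns

open scoped Classical

variable {J C : Type*} (κ : J → Option C)

/-- The identity of the input used at a position: at a random position `l` it is the input with
index `u l` of the sequence `κ l`; the deterministic positions, where `κ l = none`, are kept apart
from all others. -/
def inputKey (u : J → ℤ) (l : J) : (C × ℤ) ⊕ J :=
  (κ l).elim (.inr l) fun c => .inl (c, u l)

theorem inputKey_eq_iff {u : J → ℤ} {l l' : J} :
    inputKey κ u l = inputKey κ u l' ↔ l = l' ∨ κ l ≠ none ∧ κ l = κ l' ∧ u l = u l' := by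
  by_cases h : l = l'
  · simp [h]
  · cases hl : κ l <;> cases hl' : κ l' <;> simp [inputKey, hl, hl', h]

/-- The partition of the positions according to the inputs that are used at them. -/
def coincidence (u : J → ℤ) : Setoid J := Setoid.ker (inputKey κ u)

variable {κ}

theorem coincidence_iff {u : J → ℤ} {l l' : J} :
    coincidence κ u l l' ↔ l = l' ∨ κ l ≠ none ∧ κ l = κ l' ∧ u l = u l' :=
  inputKey_eq_iff κ

theorem apply_eq_of_coincidence {u : J → ℤ} {l l' : J} (h : coincidence κ u l l') : u l = u l' :=
  (coincidence_iff.1 h).elim (congrArg u) fun h => h.2.2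

/-- The index vector on `Option J` that is constant on the blocks of the partition `π` of `J`. -/
def blockInputs (π : Setoid J) (t : Option (Quotient π) → ℤ) (o : Option J) : ℤ :=
  t (o.map (Quotient.mk π))

theorem surjective_option_map_mk (π : Setoid J) :
    Function.Surjective (Option.map (Quotient.mk π))
  | none => ⟨none, rfl⟩
  | some β => β.inductionOn fun l => ⟨some l, rfl⟩

theorem blockInputs_injective (π : Setoid J) : Function.Injective (blockInputs π) :=
  (surjective_option_map_mk π).injective_comp_right

theorem blockInputs_out {π : Setoid J} {y : Option J → ℤ}
    (hy : coincidence κ (fun l => y (some l)) = π) :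
    blockInputs π (fun o => y (o.map Quotient.out)) = y := by
  funext o
  cases o with
  | none => rfl
  | some l =>
    have : coincidence κ (fun l => y (some l)) (Quotient.mk π l).out l :=
      hy ▸ Quotient.mk_out l
    exact apply_eq_of_coincidence this

instance finite_setoid [Finite J] : Finite (Setoid J) :=
  Finite.of_injective (fun π : Setoid J => π.r) fun _ _ h =>
    Setoid.ext fun a b => iff_of_eq (congrFun (congrFun h a) b)

variable [Fintype J]

variable (κ) in
/-- The positions at which a random input is used. -/
def randomPositions : Finset J := Finset.univ.filter fun l => κ l ≠ none

theorem mem_randomPositions {l : J} : l ∈ randomPositions κ ↔ κ l ≠ none := by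
  simp [randomPositions]

theorem blockInputs_mem_latticeBox_iff [DecidableEq J] {π : Setoid J} {n : ℕ}
    {t : Option (Quotient π) → ℤ} :
    blockInputs π t ∈ latticeBox (Option J) n ↔ t ∈ latticeBox (Option (Quotient π)) n := by
  simp only [latticeBox, Fintype.mem_piFinset]
  exact ((surjective_option_map_mk π).forall (p := fun o => t o ∈ Finset.Icc (-n : ℤ) n)).symm

variable (κ) in
theorem sum_latticeBox_eq_sum_coincidence [DecidableEq J] [Fintype (Setoid J)] {M : Type*}
    [AddCommMonoid M] (n : ℕ) (G : (Option J → ℤ) → M) :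
    ∑ y ∈ latticeBox (Option J) n, G y =
      ∑ π : Setoid J, ∑ t ∈ latticeBox (Option (Quotient π)) n,
        if coincidence κ (fun l => blockInputs π t (some l)) = π then G (blockInputs π t)
        else 0 := by
  rw [← Finset.sum_fiberwise _ fun y => coincidence κ fun l => y (some l)]
  refine Finset.sum_congr rfl fun π _ => ?_
  rw [← Finset.sum_filter]
  refine (Finset.sum_bij (fun t _ => blockInputs π t) (fun t ht => ?_)
    (fun t _ t' _ h => blockInputs_injective π h) (fun y hy => ?_) fun t _ => rfl).symm
  · rw [Finset.mem_filter] at ht ⊢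
    rwa [blockInputs_mem_latticeBox_iff]
  · rw [Finset.mem_filter] at hy
    refine ⟨_, Finset.mem_filter.2 ?_, blockInputs_out hy.2⟩
    rwa [← blockInputs_mem_latticeBox_iff, blockInputs_out hy.2]

variable (κ) in
/-- The blocks of a partition that contain random positions. -/
noncomputable def randomBlocks (π : Setoid J) : Finset (Quotient π) :=
  (randomPositions κ).image (Quotient.mk π)

variable (κ) in
/-- The summation variables that range over an interval of length of order `n`: the starting point
`none` of a path and the random blocks. The other blocks carry summable weights. -/
noncomputable def scalingCoordinates (π : Setoid J) : Finset (Option (Quotient π)) :=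
  Finset.insertNone (randomBlocks κ π)

variable (κ) in
/-- Every random input that is used is used at least twice. -/
def HasNoSingleton (π : Setoid J) : Prop :=
  ∀ l ∈ randomPositions κ, ∃ l', l' ≠ l ∧ π l l'

variable (κ) in
/-- Every random input that is used is used exactly twice. -/
def IsPairing (π : Setoid J) : Prop :=
  ∀ l ∈ randomPositions κ, ∃! l', l' ≠ l ∧ π l l'

variable (κ) in
/-- The partitions that arise from the coincidences of inputs. -/
def IsInputPattern (π : Setoid J) : Prop := ∃ u, coincidence κ u = π

namespace IsInputPattern

variable {π : Setoid J} (hπ : IsInputPattern κ π)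
include hπ

theorem eq_of_rel {l l' : J} (hl : l ∉ randomPositions κ) (h : π l l') : l = l' := by
  obtain ⟨u, rfl⟩ := hπ
  exact (coincidence_iff.1 h).resolve_right fun h => hl (mem_randomPositions.2 h.1)

theorem mem_randomPositions_iff {l l' : J} (h : π l l') :
    l ∈ randomPositions κ ↔ l' ∈ randomPositions κ := by
  obtain ⟨u, rfl⟩ := hπ
  rcases coincidence_iff.1 h with rfl | ⟨-, h, -⟩
  · rfl
  · rw [mem_randomPositions, mem_randomPositions, h]

theorem mk_mem_randomBlocks {l : J} :
    Quotient.mk π l ∈ randomBlocks κ π ↔ l ∈ randomPositions κ := by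
  refine ⟨fun h => ?_, Finset.mem_image_of_mem _⟩
  obtain ⟨l', hl', h⟩ := Finset.mem_image.1 h
  exact (hπ.mem_randomPositions_iff (Quotient.exact h)).1 hl'

theorem some_mk_mem_scalingCoordinates {l : J} :
    some (Quotient.mk π l) ∈ scalingCoordinates κ π ↔ l ∈ randomPositions κ := by
  rw [scalingCoordinates, Finset.some_mem_insertNone, hπ.mk_mem_randomBlocks]

theorem mem_fiber_of_rel {l l' : J} (hl : l ∈ randomPositions κ) (h : π l l') :
    l' ∈ (randomPositions κ).filter fun k => Quotient.mk π k = Quotient.mk π l :=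
  Finset.mem_filter.2 ⟨(hπ.mem_randomPositions_iff h).1 hl, (Quotient.sound h).symm⟩

theorem two_le_card_fiber (hs : HasNoSingleton κ π) {β : Quotient π}
    (hβ : β ∈ randomBlocks κ π) :
    2 ≤ ((randomPositions κ).filter fun l => Quotient.mk π l = β).card := by
  obtain ⟨l, hl, rfl⟩ := Finset.mem_image.1 hβ
  obtain ⟨l', hne, h⟩ := hs l hl
  exact Finset.one_lt_card.2
    ⟨l, hπ.mem_fiber_of_rel hl (π.refl l), l', hπ.mem_fiber_of_rel hl h, hne.symm⟩

theorem two_mul_card_randomBlocks_le (hs : HasNoSingleton κ π) :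
    2 * (randomBlocks κ π).card ≤ (randomPositions κ).card :=
  Finset.mul_card_image_le_card _ _ fun _ hβ => hπ.two_le_card_fiber hs hβ

theorem card_fiber_eq_two (hs : HasNoSingleton κ π)
    (hc : 2 * (randomBlocks κ π).card = (randomPositions κ).card) {β : Quotient π}
    (hβ : β ∈ randomBlocks κ π) :
    ((randomPositions κ).filter fun l => Quotient.mk π l = β).card = 2 := by
  rw [Finset.card_eq_sum_card_image (Quotient.mk π) (randomPositions κ), mul_comm, ← smul_eq_mul,
    ← Finset.sum_const] at hc
  exact ((Finset.sum_eq_sum_iff_of_le fun β hβ => hπ.two_le_card_fiber hs hβ).1 hc β hβ).symm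

theorem isPairing (hs : HasNoSingleton κ π)
    (hc : 2 * (randomBlocks κ π).card = (randomPositions κ).card) : IsPairing κ π := by
  intro l hl
  obtain ⟨l', hne, h⟩ := hs l hl
  refine ⟨l', ⟨hne, h⟩, fun k ⟨hkl, hk⟩ => by_contra fun hkl' => ?_⟩
  have three_le := Finset.two_lt_card.2 ⟨l, hπ.mem_fiber_of_rel hl (π.refl l), l',
    hπ.mem_fiber_of_rel hl h, k, hπ.mem_fiber_of_rel hl hk, hne.symm, Ne.symm hkl, Ne.symm hkl'⟩
  exact three_le.ne' (hπ.card_fiber_eq_two hs hc (Finset.mem_image_of_mem _ hl))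

theorem prod_compl_randomPositions [DecidableEq J] {M : Type*} [CommMonoidWithZero M]
    (g : J → ℤ → M) (t : Option (Quotient π) → ℤ) :
    ∏ l ∈ (randomPositions κ)ᶜ, g l (blockInputs π t (some l)) =
      ∏ v ∈ (scalingCoordinates κ π)ᶜ, v.elim (fun _ => 0) (fun β => g β.out) (t v) := by
  refine Finset.prod_bij (fun l _ => some (Quotient.mk π l)) (fun l hl => ?_)
    (fun l hl l' _ h => ?_) (fun v hv => ?_) (fun l hl => ?_)
  · rw [Finset.mem_compl] at hl ⊢
    rwa [hπ.some_mk_mem_scalingCoordinates]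
  · exact hπ.eq_of_rel (Finset.mem_compl.1 hl) (Quotient.exact (Option.some_injective _ h))
  · rw [Finset.mem_compl] at hv
    rcases v with _ | β
    · exact absurd (Finset.none_mem_insertNone) hv
    · induction β using Quotient.inductionOn with
      | h l =>
        rw [hπ.some_mk_mem_scalingCoordinates] at hv
        exact ⟨l, Finset.mem_compl.2 hv, rfl⟩
  · have : (Quotient.mk π l).out = l :=
      (hπ.eq_of_rel (Finset.mem_compl.1 hl) (π.symm (Quotient.mk_out l))).symm
    rw [Option.elim_some, this]
    rfl

end IsInputPattern

end Patterns

/-! ### Asymptotics of sums over closed paths -/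

section BlockFactor

/-- The ratio of the number `n ^ b` of choices of the random inputs to the normalization
`√n ^ r`. -/
noncomputable def blockFactor (b r : ℕ) (n : ℕ) : ℝ := (n : ℝ) ^ b * ((√n)⁻¹) ^ r

theorem blockFactor_eq {b r : ℕ} (h : 2 * b ≤ r) {n : ℕ} (hn : 1 ≤ n) :
    blockFactor b r n = ((√n)⁻¹) ^ (r - 2 * b) := by
  have sqrt_pos : (0 : ℝ) < √n := Real.sqrt_pos.2 (by exact_mod_cast hn)
  obtain ⟨k, rfl⟩ := Nat.exists_eq_add_of_le h
  have n_eq : (n : ℝ) = √n ^ 2 := (Real.sq_sqrt (Nat.cast_nonneg n)).symm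
  rw [blockFactor, Nat.add_sub_cancel_left, pow_add, ← mul_assoc]
  nth_rewrite 1 [n_eq]
  rw [← pow_mul, ← mul_pow, mul_inv_cancel₀ sqrt_pos.ne', one_pow, one_mul]

theorem tendsto_blockFactor {b r : ℕ} (h : 2 * b < r) :
    Tendsto (blockFactor b r) atTop (𝓝 0) := by
  have tendsto_inv_sqrt : Tendsto (fun n : ℕ => (√(n : ℝ))⁻¹) atTop (𝓝 0) :=
    tendsto_inv_atTop_zero.comp (Real.tendsto_sqrt_atTop.comp tendsto_natCast_atTop_atTop)
  have tendsto_pow := tendsto_inv_sqrt.pow (r - 2 * b)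
  rw [zero_pow (by omega)] at tendsto_pow
  refine tendsto_pow.congr' ?_
  filter_upwards [eventually_ge_atTop 1] with n hn
  exact (blockFactor_eq h.le hn).symm

theorem blockFactor_nonneg (b r n : ℕ) : 0 ≤ blockFactor b r n := by
  unfold blockFactor
  positivity

theorem blockFactor_le_one {b r : ℕ} (h : 2 * b ≤ r) {n : ℕ} (hn : 1 ≤ n) :
    blockFactor b r n ≤ 1 := by
  rw [blockFactor_eq h hn]
  refine pow_le_one₀ (by positivity) (inv_le_one_of_one_le₀ ?_)
  rw [Real.one_le_sqrt]
  exact_mod_cast hn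

end BlockFactor

section PathSums

open scoped Classical

variable {C : Type*} {m L : ℕ}

/-- Whether the entry used in the step `l` of the path `q` lies above the antidiagonal, where the
inputs of a generalized Toeplitz matrix are those of its first sequence. -/
def pathSide (n : ℕ) (q : Fin (L + 1) → ℤ) (l : Fin L) : Bool :=
  decide (q l.castSucc + q l.succ + 2 ≤ n)

/-- The contribution of the path with step indices `y` to the expected trace of a word. The
deterministic letters have the weights `W l s k`, where `k` is the index of the input and `s` the
side of the antidiagonal, and `Φ n u s` is the expectation of the product of the random inputs. -/
noncomputable def pathWeight (x : Fin L → Letter m) (κ : Fin L → Option C)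
    (W : Fin L → Bool → ℤ → ℂ) (Φ : ℕ → (Fin L → ℤ) → (Fin L → Bool) → ℂ) (n : ℕ)
    (y : Option (Fin L) → ℤ) : ℂ :=
  if IsClosedPath n (latticePath n x y) then
    (∏ l ∈ (randomPositions κ)ᶜ, W l (pathSide n (latticePath n x y) l) (y (some l))) *
      Φ n (fun l => y (some l)) (pathSide n (latticePath n x y))
  else 0

/-- The properties of the expectations `Φ n u s` of products of independent centred random inputs,
with indices `u` and on the sides `s`, that determine the asymptotics: they are bounded, vanish if
some input is used only once, and depend only on `s` if each input is used exactly twice. -/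
structure IsCentredExpectation (κ : Fin L → Option C)
    (Φ : ℕ → (Fin L → ℤ) → (Fin L → Bool) → ℂ) (K : ℝ) : Prop where
  norm_le {n : ℕ} (hn : 1 ≤ n) (u : Fin L → ℤ) (s : Fin L → Bool) : ‖Φ n u s‖ ≤ K
  eq_zero {n : ℕ} (hn : 1 ≤ n) {u : Fin L → ℤ} (hu : ¬ HasNoSingleton κ (coincidence κ u))
    (s : Fin L → Bool) : Φ n u s = 0
  eq_of_isPairing {π : Setoid (Fin L)} (hπ : IsPairing κ π) : ∃ ψ : (Fin L → Bool) → ℂ,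
    ∀ n, 1 ≤ n → ∀ u s, coincidence κ u = π → Φ n u s = ψ s

theorem IsCentredExpectation.bound_nonneg {κ : Fin L → Option C}
    {Φ : ℕ → (Fin L → ℤ) → (Fin L → Bool) → ℂ} {K : ℝ} (hΦ : IsCentredExpectation κ Φ K) :
    0 ≤ K :=
  (norm_nonneg _).trans (hΦ.norm_le le_rfl 0 fun _ => true)

/-- A bound for the weights of a deterministic letter on both sides of the antidiagonal. -/
noncomputable def weightMajorant (W : Fin L → Bool → ℤ → ℂ) (l : Fin L) (k : ℤ) : ℝ :=
  ‖W l true k‖ + ‖W l false k‖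

theorem weightMajorant_nonneg (W : Fin L → Bool → ℤ → ℂ) (l : Fin L) (k : ℤ) :
    0 ≤ weightMajorant W l k := by
  unfold weightMajorant
  positivity

theorem norm_le_weightMajorant (W : Fin L → Bool → ℤ → ℂ) (l : Fin L) (s : Bool) (k : ℤ) :
    ‖W l s k‖ ≤ weightMajorant W l k := by
  cases s
  · exact le_add_of_nonneg_left (norm_nonneg _)
  · exact le_add_of_nonneg_right (norm_nonneg _)

/-- The weight majorants as functions of the summation variables attached to blocks. A
deterministic block has only one element. -/
noncomputable def blockMajorant (W : Fin L → Bool → ℤ → ℂ) (π : Setoid (Fin L)) :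
    Option (Quotient π) → ℤ → ℝ
  | none => fun _ => 0
  | some β => weightMajorant W β.out

theorem blockMajorant_nonneg (W : Fin L → Bool → ℤ → ℂ) (π : Setoid (Fin L))
    (v : Option (Quotient π)) (k : ℤ) : 0 ≤ blockMajorant W π v k := by
  cases v
  · exact le_rfl
  · exact weightMajorant_nonneg ..

variable (x : Fin L → Letter m) {κ : Fin L → Option C} {W : Fin L → Bool → ℤ → ℂ}
  {Φ : ℕ → (Fin L → ℤ) → (Fin L → Bool) → ℂ} {K : ℝ} {π : Setoid (Fin L)}

theorem pathWeight_eq_zero_of_notMem_latticeBox {n : ℕ} {y : Option (Fin L) → ℤ}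
    (hy : y ∉ latticeBox (Option (Fin L)) n) : pathWeight x κ W Φ n y = 0 :=
  if_neg fun closed => hy <| by
    have := closed.pathInputs_mem_latticeBox x
    rwa [pathInputs_latticePath] at this

theorem norm_pathWeight_le (hΦ : IsCentredExpectation κ Φ K) {n : ℕ} (hn : 1 ≤ n)
    (y : Option (Fin L) → ℤ) : ‖pathWeight x κ W Φ n y‖ ≤
      K * ∏ l ∈ (randomPositions κ)ᶜ, weightMajorant W l (y (some l)) := by
  unfold pathWeight
  split_ifs
  · rw [norm_mul, mul_comm, norm_prod]
    exact mul_le_mul (hΦ.norm_le hn _ _)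
      (Finset.prod_le_prod (fun _ _ => norm_nonneg _) fun l _ => norm_le_weightMajorant ..)
      (Finset.prod_nonneg fun _ _ => norm_nonneg _) hΦ.bound_nonneg
  · rw [norm_zero]
    exact mul_nonneg hΦ.bound_nonneg (Finset.prod_nonneg fun l _ => weightMajorant_nonneg ..)

theorem summable_blockMajorant (hπ : IsInputPattern κ π)
    (hW : ∀ l ∉ randomPositions κ, ∀ s, Summable (W l s)) {v : Option (Quotient π)}
    (hv : v ∉ scalingCoordinates κ π) : Summable (blockMajorant W π v) := by
  rcases v with _ | β
  · exact absurd Finset.none_mem_insertNone hv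
  · rw [← β.out_eq, hπ.some_mk_mem_scalingCoordinates] at hv
    exact (hW _ hv true).norm.add (hW _ hv false).norm

theorem isIntAffine_latticePath (π : Setoid (Fin L)) (l : Fin (L + 1)) :
    IsIntAffine fun n t => latticePath n x (blockInputs π t) l := by
  induction l using Fin.induction with
  | zero => exact .coord none
  | succ l ih =>
    simp only [latticePath_succ]
    have input : IsIntAffine fun (_ : ℕ) (t : Option (Quotient π) → ℤ) =>
      blockInputs π t (some l) := .coord _
    obtain ⟨_ | _ | _, _ | _⟩ := x l
    exacts [((IsIntAffine.size.sub (.const 1)).sub ih).sub input,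
      ((IsIntAffine.size.sub (.const 1)).sub ih).sub input, ih.sub input, ih.add input,
      ih.sub input, ih.add input]

variable (κ W Φ π) in
/-- The contribution to the expected trace of the paths with coincidence pattern `π`, as a function
of the starting point and of the common input indices on the blocks of `π`. -/
noncomputable def blockTerm (n : ℕ) (t : Option (Quotient π) → ℤ) : ℂ :=
  if coincidence κ (fun l => blockInputs π t (some l)) = π then
    pathWeight x κ W Φ n (blockInputs π t)
  else 0

theorem blockTerm_eq_zero_of_not_isInputPattern (hπ : ¬ IsInputPattern κ π) (n : ℕ)
    (t : Option (Quotient π) → ℤ) : blockTerm x κ W Φ π n t = 0 :=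
  if_neg fun h => hπ ⟨_, h⟩

theorem blockTerm_eq_zero_of_not_hasNoSingleton (hΦ : IsCentredExpectation κ Φ K)
    (hs : ¬ HasNoSingleton κ π) {n : ℕ} (hn : 1 ≤ n) (t : Option (Quotient π) → ℤ) :
    blockTerm x κ W Φ π n t = 0 := by
  unfold blockTerm
  split_ifs with h
  · unfold pathWeight
    rw [hΦ.eq_zero hn (by rwa [h]), mul_zero, ite_self]
  · rfl

theorem blockTerm_eq_zero_of_notMem_latticeBox {n : ℕ} {t : Option (Quotient π) → ℤ}
    (ht : t ∉ latticeBox (Option (Quotient π)) n) : blockTerm x κ W Φ π n t = 0 := by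
  rw [← blockInputs_mem_latticeBox_iff] at ht
  unfold blockTerm
  rw [pathWeight_eq_zero_of_notMem_latticeBox x ht, ite_self]

theorem norm_blockTerm_le (hΦ : IsCentredExpectation κ Φ K) (hπ : IsInputPattern κ π) {n : ℕ}
    (hn : 1 ≤ n) (t : Option (Quotient π) → ℤ) : ‖blockTerm x κ W Φ π n t‖ ≤
      K * ∏ v ∈ (scalingCoordinates κ π)ᶜ, blockMajorant W π v (t v) := by
  have prod_eq : ∏ l ∈ (randomPositions κ)ᶜ, weightMajorant W l (blockInputs π t (some l)) =
      ∏ v ∈ (scalingCoordinates κ π)ᶜ, blockMajorant W π v (t v) := by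
    rw [hπ.prod_compl_randomPositions]
    exact Finset.prod_congr rfl fun v _ => by cases v <;> rfl
  rw [← prod_eq]
  refine le_trans ?_ (norm_pathWeight_le x hΦ hn _)
  unfold blockTerm
  split_ifs
  · rfl
  · exact norm_zero.trans_le (norm_nonneg _)

theorem blockInputs_latticePoint (hπ : IsInputPattern κ π) {l : Fin L} (hl : l ∉ randomPositions κ)
    (n : ℕ) (X : Option (Quotient π) → ℝ) :
    blockInputs π (latticePoint (scalingCoordinates κ π) n X) (some l) =
      ⌊X (some (Quotient.mk π l))⌋ :=
  latticePoint_of_notMem (v := some (Quotient.mk π l))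
    (by rwa [hπ.some_mk_mem_scalingCoordinates]) n X

section GenericPoints

variable {S : Finset (Option (Quotient π))} {X : Option (Quotient π) → ℝ}

theorem IsAffinelyGeneric.eventuallyConst_coincidence (hX : IsAffinelyGeneric S X) :
    EventuallyConst (fun n =>
      coincidence κ (fun l => blockInputs π (latticePoint S n X) (some l)) = π) atTop := by
  have rel (l l' : Fin L) : EventuallyConst (fun n =>
      (coincidence κ fun l => blockInputs π (latticePoint S n X) (some l)) l l') atTop := by
    simp only [coincidence_iff]
    exact (hX.eventuallyConst_eq (.coord (some (Quotient.mk π l)))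
      (.coord (some (Quotient.mk π l')))).comp fun p => l = l' ∨ κ l ≠ none ∧ κ l = κ l' ∧ p
  simp only [Setoid.ext_iff]
  exact (eventuallyConst_pi fun l => eventuallyConst_pi (rel l)).comp
    fun r => ∀ l l', r l l' ↔ π l l'

theorem IsAffinelyGeneric.eventuallyConst_isClosedPath (hX : IsAffinelyGeneric S X) :
    EventuallyConst (fun n =>
      IsClosedPath n (latticePath n x (blockInputs π (latticePoint S n X)))) atTop :=
  (eventuallyConst_pi fun l => (hX.eventuallyConst_le (.const 0)
      (isIntAffine_latticePath x π l)).comp₂ And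
    (hX.eventuallyConst_lt (isIntAffine_latticePath x π l) .size)).comp₂
    (fun p q => (∀ l, p l) ∧ q)
    (hX.eventuallyConst_eq (isIntAffine_latticePath x π 0) (isIntAffine_latticePath x π _))

theorem IsAffinelyGeneric.eventuallyConst_pathSide (hX : IsAffinelyGeneric S X) :
    EventuallyConst (fun n =>
      pathSide n (latticePath n x (blockInputs π (latticePoint S n X)))) atTop :=
  eventuallyConst_pi fun l =>
    ((hX.eventuallyConst_le (((isIntAffine_latticePath x π l.castSucc).add
      (isIntAffine_latticePath x π l.succ)).add (.const 2)) .size).comp fun p => decide p).congr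
    (.of_forall fun n => by simp only [pathSide, Function.comp_apply, decide_eq_decide])

theorem IsAffinelyGeneric.exists_tendsto_blockTerm
    (hX : IsAffinelyGeneric (scalingCoordinates κ π) X) (hΦ : IsCentredExpectation κ Φ K)
    (hπ : IsInputPattern κ π) (hpair : IsPairing κ π) :
    ∃ c, Tendsto (fun n => blockTerm x κ W Φ π n (latticePoint (scalingCoordinates κ π) n X))
      atTop (𝓝 c) := by
  obtain ⟨ψ, hψ⟩ := hΦ.eq_of_isPairing hpair
  have := ((hX.eventuallyConst_coincidence (κ := κ)).comp₂ And
    (hX.eventuallyConst_isClosedPath x)).comp₂ (fun p s => if p then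
      (∏ l ∈ (randomPositions κ)ᶜ, W l (s l) ⌊X (some (Quotient.mk π l))⌋) * ψ s else 0)
    (hX.eventuallyConst_pathSide x)
  obtain ⟨c, hc⟩ := eventuallyConst_iff_exists_eventuallyEq.1 this
  refine ⟨c, tendsto_const_nhds.congr' ?_⟩
  filter_upwards [hc, eventually_ge_atTop 1] with n hc hn
  rw [← hc, blockTerm, pathWeight]
  by_cases coincidence_eq : coincidence κ (fun l =>
      blockInputs π (latticePoint (scalingCoordinates κ π) n X) (some l)) = π
  swap
  · simp only [coincidence_eq, false_and, if_false]
  simp only [coincidence_eq, true_and, if_true]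
  refine if_congr Iff.rfl ?_ rfl
  rw [hψ n hn _ _ coincidence_eq]
  exact congrArg (· * _) (Finset.prod_congr rfl fun l hl => by
    rw [blockInputs_latticePoint hπ (Finset.mem_compl.1 hl)])

end GenericPoints

theorem tendsto_blockFactor_mul_blockTerm (hΦ : IsCentredExpectation κ Φ K)
    (hπ : IsInputPattern κ π) {b r : ℕ} (hbr : 2 * b < r) (X : Option (Quotient π) → ℝ) :
    Tendsto (fun n => (blockFactor b r n : ℂ) *
      blockTerm x κ W Φ π n (latticePoint (scalingCoordinates κ π) n X)) atTop (𝓝 0) := by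
  have tendsto_bound := (tendsto_blockFactor hbr).mul_const
    (K * ∏ v ∈ (scalingCoordinates κ π)ᶜ, blockMajorant W π v ⌊X v⌋)
  rw [zero_mul] at tendsto_bound
  refine squeeze_zero_norm' ?_ tendsto_bound
  filter_upwards [eventually_ge_atTop 1] with n hn
  rw [norm_mul, Complex.norm_real, Real.norm_of_nonneg (blockFactor_nonneg ..)]
  refine mul_le_mul_of_nonneg_left ((norm_blockTerm_le x hΦ hπ hn _).trans_eq ?_)
    (blockFactor_nonneg ..)
  exact congrArg (K * ·) (Finset.prod_congr rfl fun v hv => by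
    rw [latticePoint_of_notMem (Finset.mem_compl.1 hv)])

theorem ae_exists_tendsto_blockFactor_mul_blockTerm (hΦ : IsCentredExpectation κ Φ K)
    (hπ : IsInputPattern κ π) (hs : HasNoSingleton κ π) :
    ∀ᵐ X : Option (Quotient π) → ℝ, ∃ c, Tendsto (fun n =>
      (blockFactor (randomBlocks κ π).card (randomPositions κ).card n : ℂ) *
        blockTerm x κ W Φ π n (latticePoint (scalingCoordinates κ π) n X)) atTop (𝓝 c) := by
  filter_upwards [ae_isAffinelyGeneric (scalingCoordinates κ π)] with X hX
  rcases (hπ.two_mul_card_randomBlocks_le hs).lt_or_eq with hlt | heq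
  · exact ⟨0, tendsto_blockFactor_mul_blockTerm x hΦ hπ hlt X⟩
  · obtain ⟨c, hc⟩ := hX.exists_tendsto_blockTerm x (W := W) hΦ hπ (hπ.isPairing hs heq)
    refine ⟨c, hc.congr' ?_⟩
    filter_upwards [eventually_ge_atTop 1] with n hn
    rw [blockFactor_eq heq.le hn, heq, Nat.sub_self, pow_zero, Complex.ofReal_one, one_mul]

theorem normalization_eq {b r n : ℕ} (hn : 1 ≤ n) :
    (n : ℂ)⁻¹ * (((√n)⁻¹ : ℝ) : ℂ) ^ r = ((n : ℂ) ^ (b + 1))⁻¹ * blockFactor b r n := by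
  have : (n : ℂ) ≠ 0 := Nat.cast_ne_zero.2 (by omega)
  unfold blockFactor
  push_cast
  rw [pow_succ]
  field_simp

theorem exists_tendsto_sum_blockTerm (hW : ∀ l ∉ randomPositions κ, ∀ s, Summable (W l s))
    (hΦ : IsCentredExpectation κ Φ K) (π : Setoid (Fin L)) :
    ∃ c, Tendsto (fun n : ℕ => (n : ℂ)⁻¹ * (((√n)⁻¹ : ℝ) : ℂ) ^ (randomPositions κ).card *
      ∑ t ∈ latticeBox (Option (Quotient π)) n, blockTerm x κ W Φ π n t) atTop (𝓝 c) := by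
  by_cases hπ : IsInputPattern κ π
  swap
  · exact ⟨0, by simp [blockTerm_eq_zero_of_not_isInputPattern x hπ]⟩
  by_cases hs : HasNoSingleton κ π
  swap
  · refine ⟨0, tendsto_const_nhds.congr' ?_⟩
    filter_upwards [eventually_ge_atTop 1] with n hn
    simp [blockTerm_eq_zero_of_not_hasNoSingleton x hΦ hs hn]
  set b := (randomBlocks κ π).card
  set r := (randomPositions κ).card
  have hbr : 2 * b ≤ r := hπ.two_mul_card_randomBlocks_le hs
  have norm_le (n : ℕ) (hn : 1 ≤ n) (t : Option (Quotient π) → ℤ) :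
      ‖(blockFactor b r n : ℂ) * blockTerm x κ W Φ π n t‖ ≤
        K * ∏ v ∈ (scalingCoordinates κ π)ᶜ, blockMajorant W π v (t v) := by
    rw [norm_mul, Complex.norm_real, Real.norm_of_nonneg (blockFactor_nonneg ..)]
    exact (mul_le_of_le_one_left (norm_nonneg _) (blockFactor_le_one hbr hn)).trans
      (norm_blockTerm_le x hΦ hπ hn t)
  obtain ⟨c, hc⟩ := exists_tendsto_sum_latticeBox (scalingCoordinates κ π)
    (fun n t => (blockFactor b r n : ℂ) * blockTerm x κ W Φ π n t)
    (fun v hv => summable_blockMajorant hπ hW hv) (blockMajorant_nonneg W π) hΦ.bound_nonneg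
    (fun n t ht => by rw [blockTerm_eq_zero_of_notMem_latticeBox x ht, mul_zero])
    norm_le (ae_exists_tendsto_blockFactor_mul_blockTerm x hΦ hπ hs)
  refine ⟨c, hc.congr' ?_⟩
  filter_upwards [eventually_ge_atTop 1] with n hn
  rw [normalization_eq (b := b) hn, mul_assoc, ← Finset.mul_sum, scalingCoordinates,
    Finset.card_insertNone]

theorem exists_tendsto_sum_pathWeight (hW : ∀ l ∉ randomPositions κ, ∀ s, Summable (W l s))
    (hΦ : IsCentredExpectation κ Φ K) :
    ∃ c, Tendsto (fun n : ℕ => (n : ℂ)⁻¹ * (((√n)⁻¹ : ℝ) : ℂ) ^ (randomPositions κ).card *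
      ∑ y ∈ latticeBox (Option (Fin L)) n, pathWeight x κ W Φ n y) atTop (𝓝 c) := by
  have : Fintype (Setoid (Fin L)) := Fintype.ofFinite _
  choose c hc using exists_tendsto_sum_blockTerm x hW hΦ
  refine ⟨∑ π, c π, (tendsto_finsetSum Finset.univ fun π _ => hc π).congr fun n => ?_⟩
  rw [← Finset.mul_sum, sum_latticeBox_eq_sum_coincidence κ]
  rfl

end PathSums

/-! ### Moments of the random inputs -/

section Moments

variable {Ω : Type*} [MeasurableSpace Ω] {μ : Measure Ω}

theorem hasAllMoments_of_re_im {f : Ω → ℂ} (hf : Measurable f)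
    (hre : ∀ k ≥ 1, Integrable (fun ω => |(f ω).re| ^ k) μ)
    (him : ∀ k ≥ 1, Integrable (fun ω => |(f ω).im| ^ k) μ) : HasAllMoments μ f := by
  intro k
  rcases Nat.eq_zero_or_pos k with rfl | hk
  · rw [Nat.cast_zero, memLp_zero_iff_aestronglyMeasurable]
    exact hf.aestronglyMeasurable
  have memLp_of_integrable_pow {g : Ω → ℝ} (hg : Measurable g)
      (hint : Integrable (fun ω => |g ω| ^ k) μ) : MemLp g k μ := by
    refine (integrable_norm_rpow_iff hg.aestronglyMeasurable (Nat.cast_ne_zero.2 hk.ne')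
      (ENNReal.natCast_ne_top k)).1 ?_
    simpa only [ENNReal.toReal_natCast, Real.rpow_natCast, Real.norm_eq_abs] using hint
  exact memLp_re_im_iff.1 ⟨memLp_of_integrable_pow (Complex.measurable_re.comp hf) (hre k hk),
    memLp_of_integrable_pow (Complex.measurable_im.comp hf) (him k hk)⟩

theorem integral_norm_pow_le [IsFiniteMeasure μ] {f : Ω → ℂ} (hf : HasAllMoments μ f) {k : ℕ}
    (hk : 1 ≤ k) {C : ℝ}
    (hre : Integrable (fun ω => |(f ω).re| ^ k) μ ∧ ∫ ω, |(f ω).re| ^ k ∂μ ≤ C)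
    (him : Integrable (fun ω => |(f ω).im| ^ k) μ ∧ ∫ ω, |(f ω).im| ^ k ∂μ ≤ C) :
    ∫ ω, ‖f ω‖ ^ k ∂μ ≤ 2 ^ k * C := by
  calc ∫ ω, ‖f ω‖ ^ k ∂μ
      ≤ ∫ ω, 2 ^ (k - 1) * (|(f ω).re| ^ k + |(f ω).im| ^ k) ∂μ := by
        refine integral_mono (hf k).integrable_norm_pow' ((hre.1.add him.1).const_mul _) fun ω => ?_
        exact (pow_le_pow_left₀ (norm_nonneg _) (Complex.norm_le_abs_re_add_abs_im _) k).trans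
          (add_pow_le (abs_nonneg _) (abs_nonneg _) k)
    _ = 2 ^ (k - 1) * (∫ ω, |(f ω).re| ^ k ∂μ + ∫ ω, |(f ω).im| ^ k ∂μ) := by
        rw [integral_const_mul, integral_add hre.1 him.1]
    _ ≤ 2 ^ (k - 1) * (C + C) := by gcongr; exacts [hre.2, him.2]
    _ = 2 ^ k * C := by rw [← two_mul, ← mul_assoc, pow_sub_one_mul (by omega)]

theorem prod_le_one_add_sum_pow_card {ι : Type*} (T : Finset ι) {f : ι → ℝ} (hf : ∀ i, 0 ≤ f i) :
    ∏ i ∈ T, f i ≤ 1 + ∑ i ∈ T, f i ^ T.card := by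
  rcases T.eq_empty_or_nonempty with rfl | hT
  · simp
  obtain ⟨k, hk, le_apply⟩ := T.exists_max_image f hT
  calc ∏ i ∈ T, f i ≤ f k ^ T.card :=
        (Finset.prod_le_prod (fun i _ => hf i) le_apply).trans_eq (Finset.prod_const _)
    _ ≤ ∑ i ∈ T, f i ^ T.card :=
        Finset.single_le_sum (f := fun i => f i ^ T.card) (fun i _ => pow_nonneg (hf i) _) hk
    _ ≤ 1 + ∑ i ∈ T, f i ^ T.card := le_add_of_nonneg_left zero_le_one

theorem norm_integral_prod_le [IsProbabilityMeasure μ] {ι : Type*} (T : Finset ι)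
    {f : ι → Ω → ℂ} (hf : ∀ i, HasAllMoments μ (f i)) :
    ‖∫ ω, ∏ i ∈ T, f i ω ∂μ‖ ≤ 1 + ∑ i ∈ T, ∫ ω, ‖f i ω‖ ^ T.card ∂μ := by
  have integrable_pow : ∀ i ∈ T, Integrable (fun ω => ‖f i ω‖ ^ T.card) μ :=
    fun i _ => (hf i T.card).integrable_norm_pow'
  calc ‖∫ ω, ∏ i ∈ T, f i ω ∂μ‖ ≤ ∫ ω, ‖∏ i ∈ T, f i ω‖ ∂μ := norm_integral_le_integral_norm _
    _ ≤ ∫ ω, (1 + ∑ i ∈ T, ‖f i ω‖ ^ T.card) ∂μ := by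
        refine integral_mono (HasAllMoments.prod T fun i _ => hf i).integrable.norm
          ((integrable_const _).add (integrable_finsetSum _ integrable_pow)) fun ω => ?_
        simp only [norm_prod]
        exact prod_le_one_add_sum_pow_card T fun _ => norm_nonneg _
    _ = 1 + ∑ i ∈ T, ∫ ω, ‖f i ω‖ ^ T.card ∂μ := by
        rw [integral_add (integrable_const _) (integrable_finsetSum _ integrable_pow),
          integral_finsetSum _ integrable_pow, integral_const, probReal_univ, one_smul]

end Moments

/-- The value that a letter reads off from the pair `z = (a_k, b_k)` of inputs with a given index:
the input of the first sequence if `s`, conjugated if `ε`. -/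
def inputValue (ε s : Bool) (z : ℂ × ℂ) : ℂ :=
  if ε then star (if s then z.1 else z.2) else if s then z.1 else z.2

theorem measurable_inputValue (ε s : Bool) : Measurable (inputValue ε s) := by
  unfold inputValue
  cases ε <;> cases s <;> simp only [if_true, Bool.false_eq_true, if_false] <;> fun_prop

theorem norm_inputValue (ε s : Bool) (z : ℂ × ℂ) :
    ‖inputValue ε s z‖ = ‖if s then z.1 else z.2‖ := by
  cases ε <;> simp [inputValue]

/-- The real and imaginary parts of a pair of complex numbers. -/
def realCoord (z : ℂ × ℂ) : Fin 4 → ℝ := ![z.1.re, z.1.im, z.2.re, z.2.im]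

/-- The coefficients of `inputValue ε s` in terms of the real and imaginary parts. -/
def inputCoeff (ε s : Bool) : Fin 4 → ℂ :=
  let i := if ε then -Complex.I else Complex.I
  if s then ![1, i, 0, 0] else ![0, 0, 1, i]

theorem inputValue_eq_sum (ε s : Bool) (z : ℂ × ℂ) :
    inputValue ε s z = ∑ k, inputCoeff ε s k * realCoord z k := by
  cases ε <;> cases s <;>
    simp [inputValue, inputCoeff, realCoord, Fin.sum_univ_four, Complex.ext_iff]

/-- The covariance matrix of `(x, y, x', y')` in terms of the data of `InputAssumption`. -/
def covarianceMatrix (v : Fin 4 → ℝ) (ρ : Fin 6 → ℝ) : Matrix (Fin 4) (Fin 4) ℝ :=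
  !![v 0, ρ 0, ρ 1, ρ 2;
     ρ 0, v 1, ρ 3, ρ 5;
     ρ 1, ρ 3, v 2, ρ 4;
     ρ 2, ρ 5, ρ 4, v 3]

/-- The expectation of the product of two values read off from the same pair of random inputs. -/
noncomputable def pairCovariance (v : Fin 4 → ℝ) (ρ : Fin 6 → ℝ) (ε s ε' s' : Bool) : ℂ :=
  ∑ k, ∑ k', inputCoeff ε s k * inputCoeff ε' s' k' * covarianceMatrix v ρ k k'

/-- A bound for the expectations of products of at most `L` random inputs. -/
noncomputable def momentBound (c : ℕ → ℝ) (L : ℕ) : ℝ :=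
  1 + ∑ k ∈ Finset.range (L + 1), k * (2 ^ k * |c k|)

section InputMoments

variable {Ω : Type*} [MeasurableSpace Ω] {μ : Measure Ω} {v : Fin 4 → ℝ} {ρ : Fin 6 → ℝ}
  {c : ℕ → ℝ} {a b : ℤ → Ω → ℂ}

namespace InputAssumption

variable (h : InputAssumption μ v ρ c a b)
include h

theorem hasAllMoments_a (j : ℤ) : HasAllMoments μ (a j) :=
  hasAllMoments_of_re_im (h.measurable_a j) (fun k hk => (h.moment_x j k hk).1)
    fun k hk => (h.moment_y j k hk).1

theorem hasAllMoments_b (j : ℤ) : HasAllMoments μ (b j) :=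
  hasAllMoments_of_re_im (h.measurable_b j) (fun k hk => (h.moment_x' j k hk).1)
    fun k hk => (h.moment_y' j k hk).1

theorem hasAllMoments_inputValue (ε s : Bool) (j : ℤ) :
    HasAllMoments μ fun ω => inputValue ε s (a j ω, b j ω) := by
  cases ε <;> cases s
  exacts [h.hasAllMoments_b j, h.hasAllMoments_a j, (h.hasAllMoments_b j).star,
    (h.hasAllMoments_a j).star]

theorem integral_inputValue (ε s : Bool) (j : ℤ) :
    ∫ ω, inputValue ε s (a j ω, b j ω) ∂μ = 0 := by
  have integral_star (f : Ω → ℂ) (hf : ∫ ω, f ω ∂μ = 0) : ∫ ω, star (f ω) ∂μ = 0 :=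
    integral_conj.trans (by rw [hf, map_zero])
  cases ε <;> cases s
  exacts [h.mean_b j, h.mean_a j, integral_star _ (h.mean_b j), integral_star _ (h.mean_a j)]

theorem integral_norm_inputValue_pow_le [IsFiniteMeasure μ] (ε s : Bool) (j : ℤ) {k : ℕ}
    (hk : 1 ≤ k) : ∫ ω, ‖inputValue ε s (a j ω, b j ω)‖ ^ k ∂μ ≤ 2 ^ k * c k := by
  simp only [norm_inputValue]
  cases s
  · exact integral_norm_pow_le (h.hasAllMoments_b j) hk (h.moment_x' j k hk) (h.moment_y' j k hk)
  · exact integral_norm_pow_le (h.hasAllMoments_a j) hk (h.moment_x j k hk) (h.moment_y j k hk)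

theorem integral_realCoord_mul (j : ℤ) (k k' : Fin 4) :
    ∫ ω, realCoord (a j ω, b j ω) k * realCoord (a j ω, b j ω) k' ∂μ =
      covarianceMatrix v ρ k k' := by
  have swap {f g : Ω → ℝ} {r : ℝ} (hfg : ∫ ω, f ω * g ω ∂μ = r) : ∫ ω, g ω * f ω ∂μ = r := by
    simpa only [mul_comm] using hfg
  fin_cases k <;> fin_cases k' <;>
    simp [realCoord, covarianceMatrix, ← sq, h.sq_x, h.sq_y, h.sq_x', h.sq_y', h.corr_x_y,
      h.corr_x_x', h.corr_x_y', h.corr_x'_y, h.corr_x'_y', h.corr_y_y', swap (h.corr_x_y j),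
      swap (h.corr_x_x' j), swap (h.corr_x_y' j), swap (h.corr_x'_y j), swap (h.corr_x'_y' j),
      swap (h.corr_y_y' j)]

theorem hasAllMoments_realCoord (j : ℤ) (k : Fin 4) :
    HasAllMoments μ fun ω => (realCoord (a j ω, b j ω) k : ℂ) := by
  intro r
  fin_cases k
  exacts [(h.hasAllMoments_a j r).re.ofReal, (h.hasAllMoments_a j r).im.ofReal,
    (h.hasAllMoments_b j r).re.ofReal, (h.hasAllMoments_b j r).im.ofReal]

theorem integral_inputValue_mul [IsFiniteMeasure μ] (ε s ε' s' : Bool) (j : ℤ) :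
    ∫ ω, inputValue ε s (a j ω, b j ω) * inputValue ε' s' (a j ω, b j ω) ∂μ =
      pairCovariance v ρ ε s ε' s' := by
  have integrable_term (k k' : Fin 4) : Integrable (fun ω => inputCoeff ε s k *
      inputCoeff ε' s' k' * ((realCoord (a j ω, b j ω) k : ℂ) * realCoord (a j ω, b j ω) k')) μ :=
    ((h.hasAllMoments_realCoord j k).mul (h.hasAllMoments_realCoord j k')).integrable.const_mul _
  simp only [inputValue_eq_sum, Finset.sum_mul_sum, mul_mul_mul_comm _ (Complex.ofReal _)]
  rw [integral_finsetSum _ fun k _ => integrable_finsetSum _ fun k' _ => integrable_term k k',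
    pairCovariance]
  refine Finset.sum_congr rfl fun k _ => ?_
  rw [integral_finsetSum _ fun k' _ => integrable_term k k']
  refine Finset.sum_congr rfl fun k' _ => ?_
  simp only [integral_const_mul, ← Complex.ofReal_mul, integral_complex_ofReal,
    h.integral_realCoord_mul]

end InputAssumption

/-! ### Expectations of products of random inputs -/

variable {J C : Type*}

variable (μ a b) in
/-- The expectation of the product of the inputs with indices `u l`, read off on the sides `s l`
and conjugated as indicated by `ε l`, over the positions `l` in `T`. -/
noncomputable def inputMoment (ε : J → Bool) (u : J → ℤ) (s : J → Bool) (T : Finset J) : ℂ :=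
  ∫ ω, ∏ l ∈ T, inputValue (ε l) (s l) (a (u l) ω, b (u l) ω) ∂μ

variable (μ a b) in
/-- The expectation of the product of the inputs over all random positions, where the input at the
position `l` is taken from the copy `κ l` and different copies are independent. -/
noncomputable def inputExpectation [Fintype J] [Fintype C] [DecidableEq C] (κ : J → Option C)
    (ε : J → Bool) (u : J → ℤ) (s : J → Bool) : ℂ :=
  ∏ k, inputMoment μ a b ε u s (Finset.univ.filter fun l => κ l = some k)

theorem prod_image_fiber_eq_prod_image {A M : Type*} [DecidableEq J] [DecidableEq A]
    [CommMonoid M] (T : Finset J) (f : J → A) (F : Finset J → M) :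
    ∏ i ∈ T.image f, F (T.filter fun l => f l = i) =
      ∏ S ∈ T.image fun l => T.filter fun l' => f l' = f l, F S := by
  have image_eq : (T.image fun l => T.filter fun l' => f l' = f l) =
      (T.image f).image fun i => T.filter fun l => f l = i := by
    rw [Finset.image_image, Function.comp_def]
  rw [image_eq]
  refine (Finset.prod_image fun i hi i' _ heq => ?_).symm
  obtain ⟨l, hl, rfl⟩ := Finset.mem_image.1 hi
  exact (Finset.mem_filter.1 ((Finset.ext_iff.1 heq l).1 (Finset.mem_filter.2 ⟨hl, rfl⟩))).2

theorem prod_image_fiber_congr {A B M : Type*} [DecidableEq A] [DecidableEq B]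
    [CommMonoid M] (T : Finset J) {f : J → A} {g : J → B}
    (hfg : ∀ l ∈ T, ∀ l' ∈ T, f l = f l' ↔ g l = g l') (F : Finset J → M) :
    ∏ i ∈ T.image f, F (T.filter fun l => f l = i) =
      ∏ i ∈ T.image g, F (T.filter fun l => g l = i) := by
  classical
  rw [prod_image_fiber_eq_prod_image, prod_image_fiber_eq_prod_image,
    Finset.image_congr fun l hl => Finset.filter_congr fun l' hl' => hfg l' hl' l hl]

section Blocks

variable [Fintype J] {κ : J → Option C} {π : Setoid J}

open scoped Classical in
theorem prod_randomBlocks_eq_prod_copies [Fintype C] [DecidableEq C] {M : Type*} [CommMonoid M]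
    (hκ : ∀ ⦃l l'⦄, π l l' → κ l = κ l') (F : Quotient π → M) :
    ∏ β ∈ randomBlocks κ π, F β =
      ∏ k, ∏ β ∈ (Finset.univ.filter fun l => κ l = some k).image (Quotient.mk π), F β := by
  have randomBlocks_eq : randomBlocks κ π = Finset.univ.biUnion fun k =>
      (Finset.univ.filter fun l => κ l = some k).image (Quotient.mk π) := by
    rw [← Finset.biUnion_image, randomBlocks]
    congr 1
    ext l
    simp [mem_randomPositions, Option.ne_none_iff_exists']
  rw [randomBlocks_eq, Finset.prod_biUnion]
  intro k _ k' _ hne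
  refine Finset.disjoint_left.2 fun β hβ hβ' => hne ?_
  obtain ⟨l, hl, rfl⟩ := Finset.mem_image.1 hβ
  obtain ⟨l', hl', heq⟩ := Finset.mem_image.1 hβ'
  rw [Finset.mem_filter_univ] at hl hl'
  exact Option.some_injective _ (by rw [← hl, ← hl', hκ (Quotient.exact heq)])

open scoped Classical in
theorem IsPairing.exists_filter_mk_eq_pair [DecidableEq J] (hπ : IsPairing κ π) {β : Quotient π}
    (hβ : β ∈ randomBlocks κ π) : ∃ l l', l ≠ l' ∧ π l l' ∧
      (Finset.univ.filter fun k => Quotient.mk π k = β) = {l, l'} := by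
  obtain ⟨l, hl, rfl⟩ := Finset.mem_image.1 hβ
  obtain ⟨l', ⟨hne, hrel⟩, unique⟩ := hπ l hl
  refine ⟨l, l', hne.symm, hrel, ?_⟩
  ext k
  rw [Finset.mem_filter_univ, Finset.mem_insert, Finset.mem_singleton]
  refine ⟨fun hk => or_iff_not_imp_left.2 fun hkl => unique k ⟨hkl, Quotient.exact hk.symm⟩, ?_⟩
  rintro (rfl | rfl)
  exacts [rfl, Quotient.sound (π.symm hrel)]

end Blocks

variable (h : InputAssumption μ v ρ c a b) (ε : J → Bool) (u : J → ℤ) (s : J → Bool)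
include h

theorem norm_inputMoment_le [IsProbabilityMeasure μ] {T : Finset J} {L : ℕ} (hT : T.card ≤ L) :
    ‖inputMoment μ a b ε u s T‖ ≤ momentBound c L := by
  refine (norm_integral_prod_le T fun l => h.hasAllMoments_inputValue (ε l) (s l) (u l)).trans ?_
  refine add_le_add_right ?_ _
  calc ∑ l ∈ T, ∫ ω, ‖inputValue (ε l) (s l) (a (u l) ω, b (u l) ω)‖ ^ T.card ∂μ
      ≤ ∑ _l ∈ T, 2 ^ T.card * |c T.card| := Finset.sum_le_sum fun l hl =>
        (h.integral_norm_inputValue_pow_le _ _ _ (Finset.card_pos.2 ⟨l, hl⟩)).trans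
          (mul_le_mul_of_nonneg_left (le_abs_self _) (by positivity))
    _ = T.card * (2 ^ T.card * |c T.card|) := by rw [Finset.sum_const, nsmul_eq_mul]
    _ ≤ ∑ k ∈ Finset.range (L + 1), k * (2 ^ k * |c k|) :=
        Finset.single_le_sum (f := fun k : ℕ => (k : ℝ) * (2 ^ k * |c k|))
          (fun k _ => by positivity) (Finset.mem_range.2 (Nat.lt_succ_of_le hT))

theorem inputMoment_eq_prod_image (T : Finset J) :
    inputMoment μ a b ε u s T =
      ∏ j ∈ T.image u, inputMoment μ a b ε u s (T.filter fun l => u l = j) := by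
  have indep : iIndepFun (fun (j : T.image u) ω => (a j ω, b j ω)) μ :=
    h.indep.precomp Subtype.val_injective
  have factorization := indep.integral_fun_prod_comp
    (f := fun (j : T.image u) z => ∏ l ∈ T with u l = j, inputValue (ε l) (s l) z)
    (fun j => ((h.measurable_a j).prodMk (h.measurable_b j)).aemeasurable)
    (fun j => (Finset.measurable_fun_prod _ fun l _ =>
      measurable_inputValue _ _).aestronglyMeasurable)
  have prod_fiber (j : ℤ) (ω : Ω) :
      ∏ l ∈ T with u l = j, inputValue (ε l) (s l) (a j ω, b j ω) =
        ∏ l ∈ T with u l = j, inputValue (ε l) (s l) (a (u l) ω, b (u l) ω) :=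
    Finset.prod_congr rfl fun l hl => by rw [(Finset.mem_filter.1 hl).2]
  simp only [prod_fiber] at factorization
  rw [← Finset.prod_coe_sort, inputMoment]
  refine Eq.trans (integral_congr_ae (.of_forall fun ω => ?_)) factorization
  exact (Finset.prod_fiberwise_of_maps_to (fun l hl => Finset.mem_image_of_mem u hl) _).symm.trans
    (Finset.prod_coe_sort ..).symm

theorem inputMoment_singleton (l : J) : inputMoment μ a b ε u s {l} = 0 := by
  simp only [inputMoment, Finset.prod_singleton]
  exact h.integral_inputValue _ _ _

theorem inputMoment_pair [IsFiniteMeasure μ] [DecidableEq J] {l l' : J} (hne : l ≠ l')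
    (hu : u l = u l') :
    inputMoment μ a b ε u s {l, l'} = pairCovariance v ρ (ε l) (s l) (ε l') (s l') := by
  simp only [inputMoment, Finset.prod_pair hne, ← hu]
  exact h.integral_inputValue_mul _ _ _ _ _

variable [Fintype J] [Fintype C] [DecidableEq C] {κ : J → Option C}

open scoped Classical in
theorem inputExpectation_eq_prod_randomBlocks {u : J → ℤ} {π : Setoid J}
    (hπ : coincidence κ u = π) :
    inputExpectation μ a b κ ε u s = ∏ β ∈ randomBlocks κ π,
      inputMoment μ a b ε u s (Finset.univ.filter fun l => Quotient.mk π l = β) := by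
  subst hπ
  set π := coincidence κ u
  have apply_eq ⦃l l' : J⦄ (hl : π l l') : κ l = κ l' :=
    (coincidence_iff.1 hl).elim (congrArg κ) fun hl => hl.2.1
  rw [prod_randomBlocks_eq_prod_copies apply_eq]
  refine Finset.prod_congr rfl fun k _ => ?_
  rw [inputMoment_eq_prod_image h, prod_image_fiber_congr (g := Quotient.mk π)]
  · refine Finset.prod_congr rfl fun β hβ => congrArg _ ?_
    obtain ⟨l, hl, rfl⟩ := Finset.mem_image.1 hβ
    rw [Finset.filter_filter]
    refine Finset.filter_congr fun l' _ => and_iff_right_of_imp fun heq => ?_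
    rw [apply_eq (Quotient.exact heq), (Finset.mem_filter_univ l).1 hl]
  · intro l hl l' hl'
    rw [Finset.mem_filter_univ] at hl hl'
    rw [Quotient.eq]
    exact ⟨fun hu => coincidence_iff.2 (.inr ⟨by simp [hl], hl.trans hl'.symm, hu⟩),
      apply_eq_of_coincidence⟩

theorem inputExpectation_eq_zero {u : J → ℤ} (hu : ¬ HasNoSingleton κ (coincidence κ u)) :
    inputExpectation μ a b κ ε u s = 0 := by
  classical
  simp only [HasNoSingleton, not_forall, not_exists, not_and] at hu
  obtain ⟨l, hl, eq_of_rel⟩ := hu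
  rw [inputExpectation_eq_prod_randomBlocks h ε s rfl]
  refine Finset.prod_eq_zero (Finset.mem_image_of_mem _ hl) ?_
  convert inputMoment_singleton h ε u s l
  ext l'
  rw [Finset.mem_filter_univ, Finset.mem_singleton]
  exact ⟨fun heq => by_contra fun hne => eq_of_rel l' hne (Quotient.exact heq.symm),
    fun heq => by rw [heq]⟩

end InputMoments

theorem isCentredExpectation_inputExpectation {Ω : ℕ → Type*} [∀ n, MeasurableSpace (Ω n)]
    {μ : ∀ n, Measure (Ω n)} [∀ n, IsProbabilityMeasure (μ n)] {v : Fin 4 → ℝ} {ρ : Fin 6 → ℝ}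
    {c : ℕ → ℝ} {a b : ∀ n, ℤ → Ω n → ℂ}
    (hab : ∀ n, 1 ≤ n → InputAssumption (μ n) v ρ c (a n) (b n)) {C : Type*} [Fintype C]
    [DecidableEq C] {L : ℕ} (κ : Fin L → Option C) (ε : Fin L → Bool) :
    IsCentredExpectation κ (fun n => inputExpectation (μ n) (a n) (b n) κ ε)
      (momentBound c L ^ Fintype.card C) where
  norm_le {n} hn u s := by
    rw [inputExpectation, norm_prod]
    calc ∏ k, ‖inputMoment (μ n) (a n) (b n) ε u s (Finset.univ.filter fun l => κ l = some k)‖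
        ≤ ∏ _k : C, momentBound c L := Finset.prod_le_prod (fun _ _ => norm_nonneg _) fun _ _ =>
          norm_inputMoment_le (hab n hn) ε u s (card_finset_fin_le _)
      _ = momentBound c L ^ Fintype.card C := Finset.prod_const _
  eq_zero {n} hn _ hu s := inputExpectation_eq_zero (hab n hn) ε s hu
  eq_of_isPairing {π} hπ := by
    classical
    choose l l' hne hrel hpair using fun β : randomBlocks κ π => hπ.exists_filter_mk_eq_pair β.2
    refine ⟨fun s => ∏ β, pairCovariance v ρ (ε (l β)) (s (l β)) (ε (l' β)) (s (l' β)),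
      fun n hn u s hu => ?_⟩
    rw [inputExpectation_eq_prod_randomBlocks (hab n hn) ε s hu, ← Finset.prod_coe_sort]
    refine Finset.prod_congr rfl fun β _ => ?_
    rw [← inputMoment_pair (hab n hn) ε u s (hne β)
      (apply_eq_of_coincidence (hu ▸ hrel β)), ← hpair β]

/-! ### Mixed moments of the matrices -/

section Entries

variable {m n : ℕ}

/-- The random matrix of which a letter is a factor; `none` for the deterministic letters. -/
def copyIndex : Letter m → Option (Fin m)
  | (.rand i, _) => some i
  | _ => none

theorem ne_perm_of_copyIndex_eq_some {x : Letter m} {k : Fin m} (hx : copyIndex x = some k) :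
    x.1 ≠ .perm := by
  obtain ⟨_ | i | i, ε⟩ := x <;> cases hx
  nofun

/-- The entry with input index `k` of the matrix of a deterministic letter, on the side `s` of the
antidiagonal. (The value `1` for random letters is never used.) -/
def deterministicWeight (d' d'' : Fin m → ℤ → ℂ) : Letter m → Bool → ℤ → ℂ
  | (.perm, _), _, k => if k = 0 then 1 else 0
  | (.rand _, _), _, _ => 1
  | (.det i, ε), s, k => inputValue ε s (d' i k, d'' i k)

theorem summable_deterministicWeight {d' d'' : Fin m → ℤ → ℂ}
    (hd' : ∀ i, Summable fun k => ‖d' i k‖) (hd'' : ∀ i, Summable fun k => ‖d'' i k‖)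
    {x : Letter m} (hx : copyIndex x = none) (s : Bool) :
    Summable (deterministicWeight d' d'' x s) := by
  obtain ⟨_ | i | i, ε⟩ := x
  · exact summable_of_ne_finset_zero (s := {0}) fun k hk =>
      if_neg (Finset.mem_singleton.not.1 hk)
  · exact absurd hx (Option.some_ne_none i)
  · refine .of_norm ?_
    simp only [deterministicWeight, norm_inputValue]
    cases s
    exacts [hd'' i, hd' i]

/-- The entry `(p, q)` of `A` or, if `ε`, of its adjoint. The matrices are regarded as plain arrays,
which carry a measurable structure. -/
def starEntry (ε : Bool) (p q : Fin n) (A : Fin n → Fin n → ℂ) : ℂ :=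
  if ε then star (A q p) else A p q

theorem measurable_starEntry (ε : Bool) (p q : Fin n) : Measurable (starEntry ε p q) := by
  unfold starEntry
  cases ε <;> simp only [if_true, Bool.false_eq_true, if_false] <;> fun_prop

theorem HasAllMoments.starEntry {Ω : Type*} [MeasurableSpace Ω] {μ : Measure Ω}
    {A : Ω → Matrix (Fin n) (Fin n) ℂ} (hA : ∀ r s, HasAllMoments μ fun ω => A ω r s) (ε : Bool)
    (p q : Fin n) : HasAllMoments μ fun ω => starEntry ε p q (A ω) := by
  cases ε
  exacts [hA p q, (hA q p).star]

theorem starEntry_genToeplitz (x : Letter m) (hx : x.1 ≠ .perm) (s t : ℤ → ℂ) (p q : Fin n) :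
    starEntry x.2 p q (genToeplitz n s t) = inputValue x.2 (decide ((p : ℤ) + q + 2 ≤ n))
      (s (stepIndex n x p q), t (stepIndex n x p q)) := by
  have above_iff : (p : ℕ) + 1 + (q + 1) ≤ n ↔ (p : ℤ) + q + 2 ≤ n := by omega
  have above_iff' : (q : ℕ) + 1 + (p + 1) ≤ n ↔ (p : ℤ) + q + 2 ≤ n := by omega
  obtain ⟨_ | _ | _, _ | _⟩ := x <;>
    simp_all [starEntry, inputValue, genToeplitz, stepIndex]

theorem starEntry_scaledToeplitz {Ω : Type*} (x : Letter m) (hx : x.1 ≠ .perm)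
    (a b : ℤ → Ω → ℂ) (ω : Ω) (p q : Fin n) :
    starEntry x.2 p q (scaledToeplitz n a b ω) = (((√n)⁻¹ : ℝ) : ℂ) *
      inputValue x.2 (decide ((p : ℤ) + q + 2 ≤ n))
        (a (stepIndex n x p q) ω, b (stepIndex n x p q) ω) := by
  rw [← starEntry_genToeplitz x hx (fun j => a j ω) (fun j => b j ω), scaledToeplitz]
  cases x.2 <;> simp [starEntry]

theorem starEntry_backwardIdentity (ε : Bool) (p q : Fin n) :
    starEntry ε p q (backwardIdentity n) = if (n : ℤ) - 1 - p - q = 0 then 1 else 0 := by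
  have eq_rev_iff : q = p.rev ↔ (n : ℤ) - 1 - p - q = 0 := by
    rw [Fin.ext_iff, Fin.val_rev]
    omega
  have eq_rev_iff' : p = q.rev ↔ (n : ℤ) - 1 - p - q = 0 := by
    rw [Fin.ext_iff, Fin.val_rev]
    omega
  cases ε <;> simp [starEntry, backwardIdentity, eq_rev_iff, eq_rev_iff']

theorem starEntry_matrixFamily_of_copyIndex_eq_none {Ω : ℕ → Type*}
    (B : Fin m → ∀ n, Ω n → Matrix (Fin n) (Fin n) ℂ) (d' d'' : Fin m → ℤ → ℂ) (ω : Ω n)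
    {x : Letter m} (hx : copyIndex x = none) (p q : Fin n) :
    starEntry x.2 p q (matrixFamily B d' d'' x.1 n ω) =
      deterministicWeight d' d'' x (decide ((p : ℤ) + q + 2 ≤ n)) (stepIndex n x p q) := by
  obtain ⟨_ | i | i, ε⟩ := x
  · exact starEntry_backwardIdentity ε p q
  · exact absurd hx (Option.some_ne_none i)
  · exact starEntry_genToeplitz (.det i, ε) nofun (d' i) (d'' i) p q

theorem matrixFamily_of_copyIndex_eq_some {Ω : ℕ → Type*}
    (B : Fin m → ∀ n, Ω n → Matrix (Fin n) (Fin n) ℂ) (d' d'' : Fin m → ℤ → ℂ) (ω : Ω n)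
    {x : Letter m} {k : Fin m} (hx : copyIndex x = some k) :
    matrixFamily B d' d'' x.1 n ω = B k n ω := by
  obtain ⟨_ | i | i, ε⟩ := x <;> cases hx
  rfl

theorem hasAllMoments_matrixFamily {Ω : ℕ → Type*} [MeasurableSpace (Ω n)] {μ : Measure (Ω n)}
    [IsFiniteMeasure μ] {B : Fin m → ∀ n, Ω n → Matrix (Fin n) (Fin n) ℂ} (d' d'' : Fin m → ℤ → ℂ)
    (hB : ∀ i r s, HasAllMoments μ fun ω => B i n ω r s) (x : MatrixLabel m) (r s : Fin n) :
    HasAllMoments μ fun ω => matrixFamily B d' d'' x n ω r s := by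
  cases x with
  | perm => exact .const _
  | rand i => exact hB i r s
  | det i => exact .const _

end Entries

section Copies

variable {ι Ω Ω₀ : Type*} [MeasurableSpace Ω] [MeasurableSpace Ω₀] {μ : Measure Ω}
  {μ₀ : Measure Ω₀} {n : ℕ}

theorem measurable_scaledToeplitz {a b : ℤ → Ω → ℂ} (ha : ∀ j, Measurable (a j))
    (hb : ∀ j, Measurable (b j)) (n : ℕ) :
    Measurable fun ω (r s : Fin n) => scaledToeplitz n a b ω r s := by
  refine measurable_pi_lambda _ fun r => measurable_pi_lambda _ fun s => ?_
  simp only [scaledToeplitz, genToeplitz, Matrix.smul_apply, Matrix.of_apply, smul_eq_mul]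
  split
  exacts [(ha _).const_mul _, (hb _).const_mul _]

theorem InputAssumption.hasAllMoments_scaledToeplitz [IsFiniteMeasure μ] {v : Fin 4 → ℝ}
    {ρ : Fin 6 → ℝ} {c : ℕ → ℝ} {a b : ℤ → Ω → ℂ} (h : InputAssumption μ v ρ c a b)
    (r s : Fin n) : HasAllMoments μ fun ω => scaledToeplitz n a b ω r s := by
  simp only [scaledToeplitz, genToeplitz, Matrix.smul_apply, Matrix.of_apply, smul_eq_mul]
  split
  exacts [(HasAllMoments.const _).mul (h.hasAllMoments_a _),
    (HasAllMoments.const _).mul (h.hasAllMoments_b _)]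

namespace IsIndepCopies

variable {C : ι → Ω → Matrix (Fin n) (Fin n) ℂ} {M : Ω₀ → Matrix (Fin n) (Fin n) ℂ}

theorem hasAllMoments (h : IsIndepCopies μ μ₀ C M) {r s : Fin n}
    (hM : HasAllMoments μ₀ fun ω => M ω r s) (i : ι) : HasAllMoments μ fun ω => C i ω r s := by
  have ident_entry := (h.ident i).comp (u := fun A : Fin n → Fin n → ℂ => A r s) (by fun_prop)
  exact fun k => ident_entry.memLp_iff.2 (hM k)

theorem integral_prod_comp [Fintype ι] (h : IsIndepCopies μ μ₀ C M)
    {f : ι → (Fin n → Fin n → ℂ) → ℂ} (hf : ∀ i, Measurable (f i)) :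
    ∫ ω, ∏ i, f i (C i ω) ∂μ = ∏ i, ∫ ω, f i (M ω) ∂μ₀ :=
  (h.indep.integral_fun_prod_comp (fun i => (h.ident i).aemeasurable_fst)
    fun i => (hf i).aestronglyMeasurable).trans <|
    Finset.prod_congr rfl fun i _ => ((h.ident i).comp (hf i)).integral_eq

end IsIndepCopies

end Copies

section MixedMoments

variable {m n L : ℕ}

theorem prod_randomPositions {J C M : Type*} [Fintype J] [Fintype C] [DecidableEq C]
    [CommMonoid M] (κ : J → Option C) (f : J → M) :
    ∏ l ∈ randomPositions κ, f l = ∏ k, ∏ l with κ l = some k, f l := by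
  rw [← Finset.prod_fiberwise (randomPositions κ) κ, Fintype.prod_option, Finset.prod_eq_one,
    one_mul]
  · refine Finset.prod_congr rfl fun k _ =>
      Finset.prod_congr (Finset.ext fun l => ?_) fun _ _ => rfl
    rw [Finset.mem_filter, mem_randomPositions, Finset.mem_filter_univ]
    exact and_iff_right_of_imp fun hl => by simp [hl]
  · intro l hl
    rw [Finset.mem_filter, mem_randomPositions] at hl
    exact absurd hl.2 hl.1

theorem integral_prod_starEntry_scaledToeplitz {Ω : Type*} [MeasurableSpace Ω] (μ : Measure Ω)
    (a b : ℤ → Ω → ℂ) (x : Fin L → Letter m) {T : Finset (Fin L)}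
    (hT : ∀ l ∈ T, (x l).1 ≠ .perm) (p : Fin (L + 1) → Fin n) :
    ∫ ω, ∏ l ∈ T, starEntry (x l).2 (p l.castSucc) (p l.succ) (scaledToeplitz n a b ω) ∂μ =
      (((√n)⁻¹ : ℝ) : ℂ) ^ T.card *
        inputMoment μ a b (fun l => (x l).2) (fun l => pathInputs n x (fun l => p l) (some l))
          (pathSide n fun l => p l) T := by
  rw [inputMoment, ← integral_const_mul]
  refine integral_congr_ae (.of_forall fun ω => ?_)
  simp only [← Finset.prod_const, ← Finset.prod_mul_distrib]
  exact Finset.prod_congr rfl fun l hl => starEntry_scaledToeplitz (x l) (hT l hl) a b ω _ _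

theorem prod_starEntry_matrixFamily {Ω : ℕ → Type*}
    (B : Fin m → ∀ n, Ω n → Matrix (Fin n) (Fin n) ℂ) (d' d'' : Fin m → ℤ → ℂ) (ω : Ω n)
    (x : Fin L → Letter m) (p : Fin (L + 1) → Fin n) :
    ∏ l, starEntry (x l).2 (p l.castSucc) (p l.succ) (matrixFamily B d' d'' (x l).1 n ω) =
      (∏ l ∈ (randomPositions fun l => copyIndex (x l))ᶜ, deterministicWeight d' d'' (x l)
        (pathSide n (fun l => p l) l) (pathInputs n x (fun l => p l) (some l))) *
      ∏ k, ∏ l with copyIndex (x l) = some k,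
        starEntry (x l).2 (p l.castSucc) (p l.succ) (B k n ω) := by
  rw [← Finset.prod_compl_mul_prod (randomPositions fun l => copyIndex (x l)),
    prod_randomPositions]
  congr 1
  · refine Finset.prod_congr rfl fun l hl => ?_
    rw [Finset.mem_compl, mem_randomPositions, not_not] at hl
    exact starEntry_matrixFamily_of_copyIndex_eq_none B d' d'' ω hl _ _
  · refine Finset.prod_congr rfl fun k _ => Finset.prod_congr rfl fun l hl => ?_
    rw [matrixFamily_of_copyIndex_eq_some B d' d'' ω ((Finset.mem_filter_univ l).1 hl)]

theorem integral_prod_starEntry_matrixFamily {Ω : ℕ → Type*} [MeasurableSpace (Ω n)]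
    {μ : Measure (Ω n)} {Ω₀ : Type*} [MeasurableSpace Ω₀] {μ₀ : Measure Ω₀} {a b : ℤ → Ω₀ → ℂ}
    {B : Fin m → ∀ n, Ω n → Matrix (Fin n) (Fin n) ℂ}
    (hB : IsIndepCopies μ μ₀ (fun i => B i n) (scaledToeplitz n a b)) (d' d'' : Fin m → ℤ → ℂ)
    (x : Fin L → Letter m) (p : Fin (L + 1) → Fin n) :
    ∫ ω, ∏ l, starEntry (x l).2 (p l.castSucc) (p l.succ) (matrixFamily B d' d'' (x l).1 n ω) ∂μ =
      (((√n)⁻¹ : ℝ) : ℂ) ^ (randomPositions fun l => copyIndex (x l)).card *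
      ((∏ l ∈ (randomPositions fun l => copyIndex (x l))ᶜ, deterministicWeight d' d'' (x l)
        (pathSide n (fun l => p l) l) (pathInputs n x (fun l => p l) (some l))) *
      inputExpectation μ₀ a b (fun l => copyIndex (x l)) (fun l => (x l).2)
        (fun l => pathInputs n x (fun l => p l) (some l)) (pathSide n fun l => p l)) := by
  simp only [prod_starEntry_matrixFamily]
  rw [integral_const_mul, mul_left_comm,
    hB.integral_prod_comp (f := fun k A => ∏ l with copyIndex (x l) = some k,
      starEntry (x l).2 (p l.castSucc) (p l.succ) A) fun k =>
        Finset.measurable_fun_prod _ fun l _ => measurable_starEntry _ _ _,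
    ← Finset.prod_const, prod_randomPositions, inputExpectation, ← Finset.prod_mul_distrib]
  refine congrArg _ (Finset.prod_congr rfl fun k _ => ?_)
  rw [Finset.prod_const]
  exact integral_prod_starEntry_scaledToeplitz μ₀ a b x
    (fun l hl => ne_perm_of_copyIndex_eq_some ((Finset.mem_filter_univ l).1 hl)) p

theorem trace_starMonomial_ofFn {ι : Type*} (M : ι → Matrix (Fin n) (Fin n) ℂ)
    (x : Fin L → ι × Bool) :
    (starMonomial M (List.ofFn x)).trace = ∑ p : Fin (L + 1) → Fin n,
      if p 0 = p (Fin.last L) then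
        ∏ l, starEntry (x l).2 (p l.castSucc) (p l.succ) (M (x l).1) else 0 := by
  rw [starMonomial, List.map_ofFn, trace_prod_ofFn_eq_sum_paths]
  refine Finset.sum_congr rfl fun p _ =>
    if_congr Iff.rfl (Finset.prod_congr rfl fun l _ => ?_) rfl
  simp only [Function.comp, starEntry]
  split <;> simp

theorem integral_trace_starMonomial_ofFn {ι Ω : Type*} [MeasurableSpace Ω] {μ : Measure Ω}
    [IsFiniteMeasure μ] {M : ι → Ω → Matrix (Fin n) (Fin n) ℂ}
    (hM : ∀ i r s, HasAllMoments μ fun ω => M i ω r s) (x : Fin L → ι × Bool) :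
    ∫ ω, (starMonomial (fun i => M i ω) (List.ofFn x)).trace ∂μ =
      ∑ p : Fin (L + 1) → Fin n, if p 0 = p (Fin.last L) then
        ∫ ω, ∏ l, starEntry (x l).2 (p l.castSucc) (p l.succ) (M (x l).1 ω) ∂μ else 0 := by
  have integrable_prod (p : Fin (L + 1) → Fin n) : Integrable
      (fun ω => ∏ l, starEntry (x l).2 (p l.castSucc) (p l.succ) (M (x l).1 ω)) μ :=
    (HasAllMoments.prod _ fun l _ => .starEntry (hM _) _ _ _).integrable
  simp only [trace_starMonomial_ofFn, ← Finset.sum_filter]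
  exact integral_finsetSum _ fun p _ => integrable_prod p

theorem sum_pathWeight_eq_sum_closedPaths {C : Type*} (x : Fin L → Letter m)
    (κ : Fin L → Option C) (W : Fin L → Bool → ℤ → ℂ)
    (Φ : ℕ → (Fin L → ℤ) → (Fin L → Bool) → ℂ) (n : ℕ) :
    ∑ y ∈ latticeBox (Option (Fin L)) n, pathWeight x κ W Φ n y =
      ∑ p : Fin (L + 1) → Fin n, if p 0 = p (Fin.last L) then
        (∏ l ∈ (randomPositions κ)ᶜ,
          W l (pathSide n (fun l => p l) l) (pathInputs n x (fun l => p l) (some l))) *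
        Φ n (fun l => pathInputs n x (fun l => p l) (some l)) (pathSide n fun l => p l)
      else 0 := by
  refine Eq.trans ?_ (sum_closedPaths_eq_sum_latticeBox n x fun q =>
    (∏ l ∈ (randomPositions κ)ᶜ, W l (pathSide n q l) (pathInputs n x q (some l))) *
      Φ n (fun l => pathInputs n x q (some l)) (pathSide n q)).symm
  simp only [pathInputs_latticePath, pathWeight]

theorem traceState_starMonomial_matrixFamily {Ω : ℕ → Type*} [MeasurableSpace (Ω n)]
    {μ : Measure (Ω n)} [IsFiniteMeasure μ] {Ω₀ : ℕ → Type*}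
    [∀ n, MeasurableSpace (Ω₀ n)] {μ₀ : ∀ n, Measure (Ω₀ n)} {a b : ∀ n, ℤ → Ω₀ n → ℂ}
    {B : Fin m → ∀ n, Ω n → Matrix (Fin n) (Fin n) ℂ}
    (hmom : ∀ i r s, HasAllMoments μ fun ω => B i n ω r s)
    (hB : IsIndepCopies μ (μ₀ n) (fun i => B i n) (scaledToeplitz n (a n) (b n)))
    (d' d'' : Fin m → ℤ → ℂ) (x : Fin L → Letter m) :
    (traceState μ fun ω => starMonomial (fun i => matrixFamily B d' d'' i n ω) (List.ofFn x)) =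
      (n : ℂ)⁻¹ * (((√n)⁻¹ : ℝ) : ℂ) ^ (randomPositions fun l => copyIndex (x l)).card *
        ∑ y ∈ latticeBox (Option (Fin L)) n, pathWeight x (fun l => copyIndex (x l))
          (fun l => deterministicWeight d' d'' (x l)) (fun n => inputExpectation (μ₀ n) (a n) (b n)
            (fun l => copyIndex (x l)) fun l => (x l).2) n y := by
  rw [traceState, mul_assoc, sum_pathWeight_eq_sum_closedPaths, Finset.mul_sum,
    integral_trace_starMonomial_ofFn (hasAllMoments_matrixFamily d' d'' hmom)]
  simp only [integral_prod_starEntry_matrixFamily hB, mul_ite, mul_zero]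

end MixedMoments

/-! ### Joint convergence -/

theorem convergeJointly_matrixFamily {m : ℕ} {Ω₀ : ℕ → Type*} [∀ n, MeasurableSpace (Ω₀ n)]
    {μ₀ : ∀ n, Measure (Ω₀ n)} [∀ n, IsProbabilityMeasure (μ₀ n)]
    {Ω : ℕ → Type*} [∀ n, MeasurableSpace (Ω n)]
    {μ : ∀ n, Measure (Ω n)} [∀ n, IsProbabilityMeasure (μ n)]
    {v : Fin 4 → ℝ} {ρ : Fin 6 → ℝ} {c : ℕ → ℝ} {a b : ∀ n, ℤ → Ω₀ n → ℂ}
    (hab : ∀ n, 1 ≤ n → InputAssumption (μ₀ n) v ρ c (a n) (b n)) {d' d'' : Fin m → ℤ → ℂ}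
    (hd' : ∀ i, Summable fun k => ‖d' i k‖) (hd'' : ∀ i, Summable fun k => ‖d'' i k‖)
    {B : Fin m → ∀ n, Ω n → Matrix (Fin n) (Fin n) ℂ}
    (hB : ∀ n, 1 ≤ n →
      IsIndepCopies (μ n) (μ₀ n) (fun i => B i n) (scaledToeplitz n (a n) (b n))) :
    ConvergeJointly μ (matrixFamily B d' d'') := by
  have hasAllMoments_copies i n r s : HasAllMoments (μ n) fun ω => B i n ω r s :=
    (hB n r.pos).hasAllMoments ((hab n r.pos).hasAllMoments_scaledToeplitz r s) i
  refine convergeJointly_of_forall_tendsto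
    (fun i n => hasAllMoments_matrixFamily d' d'' (hasAllMoments_copies · n) i) fun w _ => ?_
  obtain ⟨r, hr⟩ := exists_tendsto_sum_pathWeight w.get
    (κ := fun l => copyIndex (w.get l)) (W := fun l => deterministicWeight d' d'' (w.get l))
    (fun l hl => summable_deterministicWeight hd' hd'' (by simpa [mem_randomPositions] using hl))
    (isCentredExpectation_inputExpectation hab _ fun l => (w.get l).2)
  refine ⟨r, hr.congr' ?_⟩
  filter_upwards [eventually_ge_atTop 1] with n hn
  have trace_eq := traceState_starMonomial_matrixFamily (hasAllMoments_copies · n) (hB n hn)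
    d' d'' w.get
  rw [List.ofFn_get] at trace_eq
  exact trace_eq.symm

/-- The word obtained from a word in the letters `κ` by replacing the letter `k` by the word `σ k`
and its adjoint by the adjoint of that word. -/
def substituteWords {ι κ : Type*} (σ : κ → List (ι × Bool)) (w : List (κ × Bool)) :
    List (ι × Bool) :=
  w.flatMap fun l => if l.2 then ((σ l.1).map fun l' => (l'.1, !l'.2)).reverse else σ l.1

theorem substituteWords_ne_nil {ι κ : Type*} {σ : κ → List (ι × Bool)} (hσ : ∀ k, σ k ≠ [])
    {w : List (κ × Bool)} (hw : w ≠ []) : substituteWords σ w ≠ [] := by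
  obtain ⟨⟨k, _ | _⟩, w, rfl⟩ := List.exists_cons_of_ne_nil hw <;>
    simp [substituteWords, hσ k]

theorem starMonomial_starMonomial {ι κ A : Type*} [Monoid A] [StarMul A] (x : ι → A)
    (σ : κ → List (ι × Bool)) (w : List (κ × Bool)) :
    starMonomial (fun k => starMonomial x (σ k)) w = starMonomial x (substituteWords σ w) := by
  induction w with
  | nil => rfl
  | cons l w ih =>
    have letter : (if l.2 then star (starMonomial x (σ l.1)) else starMonomial x (σ l.1)) =
        starMonomial x
          (if l.2 then ((σ l.1).map fun l' => (l'.1, !l'.2)).reverse else σ l.1) := by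
      split
      exacts [star_starMonomial x _, rfl]
    simp only [starMonomial, substituteWords, List.flatMap_cons, List.map_cons, List.prod_cons,
      List.map_append, List.prod_append] at ih letter ⊢
    rw [ih, letter]

theorem ConvergeJointly.starMonomial {ι κ : Type*} {Ω : ℕ → Type*} [∀ n, MeasurableSpace (Ω n)]
    {μ : ∀ n, Measure (Ω n)} [∀ n, IsFiniteMeasure (μ n)]
    {M : ι → ∀ n, Ω n → Matrix (Fin n) (Fin n) ℂ} (h : ConvergeJointly μ M)
    {σ : κ → List (ι × Bool)} (hσ : ∀ k, σ k ≠ []) :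
    ConvergeJointly μ fun k n ω => starMonomial (fun i => M i n ω) (σ k) := by
  obtain ⟨A, _, _, _, _, φ, x, hmoments, hlim⟩ := h
  refine ⟨A, _, _, _, ‹_›, φ, fun k => _root_.starMonomial x (σ k),
    fun k n r s => HasAllMoments.starMonomial (fun i => hmoments i n) (σ k) r s, fun w hw => ?_⟩
  simp only [starMonomial_starMonomial]
  exact hlim _ (substituteWords_ne_nil hσ hw)

/-! ### Hankel matrices -/

theorem backwardIdentity_mul_apply {n : ℕ} (M : Matrix (Fin n) (Fin n) ℂ) (i j : Fin n) :
    (backwardIdentity n * M) i j = M i.rev j := by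
  simp [backwardIdentity, Matrix.mul_apply]

theorem backwardIdentity_mul_self (n : ℕ) : backwardIdentity n * backwardIdentity n = 1 := by
  ext i j
  rw [backwardIdentity_mul_apply, backwardIdentity, Matrix.of_apply, Fin.rev_rev, Matrix.one_apply]
  exact if_congr eq_comm rfl rfl

theorem asymHankel_eq (n : ℕ) (s t : ℤ → ℂ) :
    asymHankel n s t = backwardIdentity n * genToeplitz n s t := by
  ext i j
  have below_iff : j < i ↔ n - (i + 1) + 1 + (j + 1) ≤ n := by
    rw [Fin.lt_def]
    omega
  have index_eq : (n : ℤ) + 1 - (i + 1) - (j + 1) = ((n - (i + 1) : ℕ) : ℤ) - j := by omega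
  simp only [backwardIdentity_mul_apply, asymHankel, genToeplitz, Matrix.of_apply, Fin.val_rev,
    below_iff, index_eq]

theorem scaledHankel_apply_rev {Ω : Type*} (n : ℕ) (a b : ℤ → Ω → ℂ) (ω : Ω) (i j : Fin n) :
    scaledHankel n a b ω i.rev j = scaledToeplitz n a b ω i j := by
  simp only [scaledHankel, scaledToeplitz, Matrix.smul_apply, asymHankel_eq,
    backwardIdentity_mul_apply, Fin.rev_rev]

theorem IsIndepCopies.backwardIdentity_mul {ι Ω Ω₀ : Type*} [MeasurableSpace Ω]
    [MeasurableSpace Ω₀] {μ : Measure Ω} {μ₀ : Measure Ω₀} {n : ℕ} {a b : ℤ → Ω₀ → ℂ}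
    {C : ι → Ω → Matrix (Fin n) (Fin n) ℂ} (h : IsIndepCopies μ μ₀ C (scaledHankel n a b)) :
    IsIndepCopies μ μ₀ (fun i ω => backwardIdentity n * C i ω) (scaledToeplitz n a b) := by
  have measurable_reverseRows :
      Measurable fun (A : Fin n → Fin n → ℂ) (r s : Fin n) => A r.rev s := by fun_prop
  constructor
  · intro i
    simp only [backwardIdentity_mul_apply, ← scaledHankel_apply_rev]
    exact (h.ident i).comp measurable_reverseRows
  · simp only [backwardIdentity_mul_apply]
    exact h.indep.comp (fun _ (A : Fin n → Fin n → ℂ) (r s : Fin n) => A r.rev s)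
      fun _ => measurable_reverseRows

/-- The monomials that express `P_n`, `P_n B` and `D` in terms of `P_n`, `B` and `D`. -/
def hankelWord {m : ℕ} : MatrixLabel m → List (MatrixLabel m × Bool)
  | .perm => [(.perm, false)]
  | .rand i => [(.perm, false), (.rand i, false)]
  | .det i => [(.det i, false)]

theorem hankelWord_ne_nil {m : ℕ} (k : MatrixLabel m) : hankelWord k ≠ [] := by
  cases k <;> exact List.cons_ne_nil _ _

theorem starMonomial_hankelWord {m : ℕ} {Ω : ℕ → Type*}
    (C : Fin m → ∀ n, Ω n → Matrix (Fin n) (Fin n) ℂ) (d' d'' : Fin m → ℤ → ℂ) (k : MatrixLabel m)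
    (n : ℕ) (ω : Ω n) :
    starMonomial (fun i => matrixFamily (fun i n ω => backwardIdentity n * C i n ω) d' d'' i n ω)
      (hankelWord k) = matrixFamily C d' d'' k n ω := by
  cases k <;>
    simp [starMonomial, hankelWord, matrixFamily, ← mul_assoc, backwardIdentity_mul_self]

theorem theorem2p2 (m : ℕ)
    -- the space of the input sequences, and the space of the independent copies, for each size
    {Ω₀ : ℕ → Type*} [∀ n, MeasurableSpace (Ω₀ n)]
    (μ₀ : ∀ n, Measure (Ω₀ n)) [∀ n, IsProbabilityMeasure (μ₀ n)]
    {Ω : ℕ → Type*} [∀ n, MeasurableSpace (Ω n)]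
    (μ : ∀ n, Measure (Ω n)) [∀ n, IsProbabilityMeasure (μ n)]
    (v : Fin 4 → ℝ) (ρ : Fin 6 → ℝ) (c : ℕ → ℝ)
    (a b : ∀ n, ℤ → Ω₀ n → ℂ)
    (hab : ∀ n, 1 ≤ n → InputAssumption (μ₀ n) v ρ c (a n) (b n))
    (d' d'' : Fin m → ℤ → ℂ)
    (hd' : ∀ i, Summable fun k => ‖d' i k‖) (hd'' : ∀ i, Summable fun k => ‖d'' i k‖) :
    -- `P_n`, independent copies of `n^{-1/2} T_{n,g}`, and the `D_{n,g}^{(i)}`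
    (∀ B : Fin m → ∀ n, Ω n → Matrix (Fin n) (Fin n) ℂ,
      (∀ n, 1 ≤ n →
        IsIndepCopies (μ n) (μ₀ n) (fun i => B i n) (scaledToeplitz n (a n) (b n))) →
      ConvergeJointly μ (matrixFamily B d' d'')) ∧
    -- in particular, `P_n`, `n^{-1/2} T_{n,g}` and a single `D_{n,g}`
    (∀ e' e'' : ℤ → ℂ, (Summable fun k => ‖e' k‖) → (Summable fun k => ‖e'' k‖) →
      ConvergeJointly μ₀ (matrixFamily (m := 1) (fun _ n => scaledToeplitz n (a n) (b n))
        (fun _ => e') (fun _ => e''))) ∧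
    -- asymmetric Hankel matrices: `H_n = P_n T_{n,g}`, and `P_n`, independent copies of
    -- `n^{-1/2} H_n`, and the `D_{n,g}^{(i)}`
    (∀ (n : ℕ) (s t : ℤ → ℂ), asymHankel n s t = backwardIdentity n * genToeplitz n s t) ∧
    (∀ C : Fin m → ∀ n, Ω n → Matrix (Fin n) (Fin n) ℂ,
      (∀ n, 1 ≤ n →
        IsIndepCopies (μ n) (μ₀ n) (fun i => C i n) (scaledHankel n (a n) (b n))) →
      ConvergeJointly μ (matrixFamily C d' d'')) := by
  refine ⟨fun B hB => convergeJointly_matrixFamily hab hd' hd'' hB, fun e' e'' he' he'' => ?_,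
    asymHankel_eq, fun C hC => ?_⟩
  · refine convergeJointly_matrixFamily hab (fun _ => he') (fun _ => he'')
      fun n hn => ⟨fun _ => .refl ?_, .of_subsingleton⟩
    exact (measurable_scaledToeplitz (hab n hn).measurable_a (hab n hn).measurable_b n).aemeasurable
  · have convergeJointly_toeplitz := convergeJointly_matrixFamily hab hd' hd''
      (B := fun i n ω => backwardIdentity n * C i n ω) fun n hn => (hC n hn).backwardIdentity_mul
    simpa only [starMonomial_hankelWord] using
      convergeJointly_toeplitz.starMonomial hankelWord_ne_nil
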